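/- Let $d\ge 0$ and let $\nu$ be a Borel probability measure on $\mathbb{R}^d$. Say that $\nu$ satisfies a log-Sobolev inequality with constant $C\in[0,\infty)$ if $$\int f^2\log f^2\,d\nu-\int f^2\,d\nu\,\log\int f^2\,d\nu\;\le\;2C\int|\nabla f|^2\,d\nu$$ for every locally Lipschitz $f\in L^2(\nu)$, where $|\nabla f|(x)=\limsup_{y\to x}\frac{|f(y)-f(x)|}{|y-x|}$ (the norm of the gradient wherever $f$ is differentiable), and let $C_{\mathsf{LSI}}(\nu)\in[0,\infty]$ be the smallest such constant ($\infty$ if there is none). Assume $0<C_{\mathsf{LSI}}(\nu)<\infty$. For $t\ge 0$ let $\gamma_t$ be the centered Gaussian measure on $\mathbb{R}^d$ with covariance $tI_d$ (also its density, when $t>0$), and for a probability measure $\mu$ let $\mu_t=\mu*\gamma_t$. Let $Q_t$ be the $L^2(\nu)$-adjoint of the heat semigroup $P_tf=f*\gamma_t$, that is, $Q_0f=f$ and $$Q_tf(y)=\frac{P_t(f\nu)(y)}{P_t\nu(y)}=\frac{\int f(x)\,\gamma_t(y-x)\,\nu(dx)}{\int\gamma_t(y-x)\,\nu(dx)}\qquad(t>0).$$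 For $p\in(1,\infty)$ and $t\ge 0$ define $q(t)\in(1,\infty)$ by $$\frac{q(t)-1}{p-1}=1+\frac{t}{C_{\mathsf{LSI}}(\nu)}.$$ Then for all $p\in(1,\infty)$, $t\ge 0$ and $f\in L^p(\nu)$ one has $Q_tf\in L^{q(t)}(\nu_t)$ and $$\|Q_tf\|_{L^{q(t)}(\nu_t)}\le\|f\|_{L^p(\nu)}.$$ In particular, for every probability measure $\mu\ll\nu$, $$\mathcal{R}_{q(t)}(\mu_t\,\|\,\nu_t)\le\mathcal{R}_p(\mu\,\|\,\nu),$$ where $\mathcal{R}_q(\mu\,\|\,\nu)=\frac{1}{q-1}\log\int\left(\frac{d\mu}{d\nu}\right)^{q}d\nu\in[0,\infty]$ if $\mu\ll\nu$, and $\mathcal{R}_q(\mu\,\|\,\nu)=\infty$ otherwise. -/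

import Mathlib

open MeasureTheory ProbabilityTheory Filter Topology
open scoped ENNReal NNReal

noncomputable section

/-- The length `|∇f|(x)` of the gradient of a locally Lipschitz function, as the local slope
`limsup_{y → x, y ≠ x} |f y - f x| / |y - x|`. It equals the norm of the gradient at every point of
differentiability, and it is defined everywhere, so that it makes sense against any measure. -/
def gradLength {d : ℕ} (f : EuclideanSpace ℝ (Fin d) → ℝ) (x : EuclideanSpace ℝ (Fin d)) : ℝ≥0∞ :=
  limsup (fun y => edist (f y) (f x) / edist y x) (𝓝[≠] x)

open Classical in
/-- The entropy `∫ g log g dπ - (∫ g dπ) log (∫ g dπ)` of a nonnegative integrable function `g`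
under a probability measure `π`. It takes values in `[0, ∞]` by Jensen's inequality, and it is `∞`
exactly when `g log g` is not integrable, because `g log g` is bounded below. -/
def entropy {d : ℕ} (π : Measure (EuclideanSpace ℝ (Fin d)))
    (g : EuclideanSpace ℝ (Fin d) → ℝ) : ℝ≥0∞ :=
  if Integrable (fun x => g x * Real.log (g x)) π then
    ENNReal.ofReal (∫ x, g x * Real.log (g x) ∂π - (∫ x, g x ∂π) * Real.log (∫ x, g x ∂π))
  else ∞

/-- The logarithmic Sobolev inequality with constant `C`: `Ent_π(f²) ≤ 2 C ∫ |∇f|² dπ` for every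
locally Lipschitz `f ∈ L²(π)`. -/
def SatisfiesLSI {d : ℕ} (π : Measure (EuclideanSpace ℝ (Fin d))) (C : ℝ≥0) : Prop :=
  ∀ f : EuclideanSpace ℝ (Fin d) → ℝ, LocallyLipschitz f → MemLp f 2 π →
    entropy π (fun x => f x ^ 2) ≤ 2 * (C : ℝ≥0∞) * ∫⁻ x, gradLength f x ^ 2 ∂π

/-- The log-Sobolev constant: the smallest `C` for which the logarithmic Sobolev inequality holds,
and `∞` if there is none. -/
def lsiConst {d : ℕ} (π : Measure (EuclideanSpace ℝ (Fin d))) : ℝ≥0∞ :=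
  ⨅ (C : ℝ≥0) (_ : SatisfiesLSI π C), (C : ℝ≥0∞)

/-- The measure `π_t = π * γ_t`, where `γ_t` is the centered Gaussian with covariance `t I`
(a point mass at the origin for `t = 0`). -/
def heatFlow {d : ℕ} (π : Measure (EuclideanSpace ℝ (Fin d))) (t : ℝ) :
    Measure (EuclideanSpace ℝ (Fin d)) :=
  π.conv (multivariateGaussian 0 (t • (1 : Matrix (Fin d) (Fin d) ℝ)))

/-- The density of `γ_t` with respect to Lebesgue measure, for `t > 0`. -/
def heatKernel {d : ℕ} (t : ℝ) (z : EuclideanSpace ℝ (Fin d)) : ℝ :=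
  (2 * Real.pi * t) ^ (-(d : ℝ) / 2) * Real.exp (-‖z‖ ^ 2 / (2 * t))

/-- For `t > 0`, the function `P_t(f π)`, that is the Lebesgue density
`y ↦ ∫ f(x) γ_t(y - x) π(dx)` of the convolution of the measure `f π` with `γ_t`. -/
def heatDensity {d : ℕ} (π : Measure (EuclideanSpace ℝ (Fin d))) (t : ℝ)
    (f : EuclideanSpace ℝ (Fin d) → ℝ) (y : EuclideanSpace ℝ (Fin d)) : ℝ :=
  ∫ x, f x * heatKernel t (y - x) ∂π

/-- The adjoint `Q_t` of the heat semigroup `P_t : L²(π_t) → L²(π)`: `Q_0 = id`, and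
`Q_t f = P_t(f π) / P_t π` for `t > 0`. -/
def heatAdjoint {d : ℕ} (π : Measure (EuclideanSpace ℝ (Fin d))) (t : ℝ)
    (f : EuclideanSpace ℝ (Fin d) → ℝ) (y : EuclideanSpace ℝ (Fin d)) : ℝ :=
  if t = 0 then f y else heatDensity π t f y / heatDensity π t (fun _ => 1) y

open Classical in
/-- The `q`-Rényi divergence `(q - 1)⁻¹ log ∫ (dμ/dν)^q dν` for `q ∈ (1, ∞)`, with the usual value
`∞` if `μ` is not absolutely continuous with respect to `ν`. -/
def renyiDiv {d : ℕ} (q : ℝ) (μ ν : Measure (EuclideanSpace ℝ (Fin d))) : EReal :=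
  if μ ≪ ν then (((q - 1)⁻¹ : ℝ) : EReal) * ENNReal.log (∫⁻ x, μ.rnDeriv ν x ^ q ∂ν) else ⊤

end

/-!
The theorem is hypercontractivity of `Q_t`, and by duality it says that the heat semigroup `P_t`
maps `L^Q(ν_t)` to `L^P(ν)` with norm at most one, where `P = p / (p - 1)` and `Q = q / (q - 1)`
are the conjugate exponents; the relation between `p` and `q` reads `P - 1 = (1 + t / C) (Q - 1)`,
with `C` the log-Sobolev constant of `ν`.

For fixed `t > 0` and a positive function `h = exp u`, bounded above and below, both sides of the
dual inequality belong to the family `‖(P_t h^b)^(1/b)‖_{L^a(ν)}`: at `(b, a) = (1, P)` it is `‖P_t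
h‖_{L^P(ν)}`, and at `(Q, Q)` it is `‖h‖_{L^Q(ν_t)}`. Along the segment `a(b) = P - (t / C) (b -
1)` joining these two points the norm is nondecreasing in `b` (`log_integral_exp_logHeat_le`). Its
logarithmic derivative has two contributions. Lowering `a` costs a multiple of the entropy of `(P_t
h^b)^(a/b)` under `ν`, which the log-Sobolev inequality of `ν` bounds by an energy
(`integral_exp_mul_sub_le`). Raising `b` gains the local entropy `P_t(g log g) - P_t g log P_t g`
of `g = h^b`, which the reverse local log-Sobolev inequality bounds below by the energy `(t / 2)
|∇P_t g|² / P_t g` (`half_mul_sq_norm_le_integral_exp_mul`). The two energies cancel exactly for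
the slope `-t / C` (`entropy_balance`).

The reverse local inequality needs no semigroup calculus. The gradient `∇ log P_t g` is `t⁻¹` times
the mean of the Gaussian tilted by `g`, and among the densities with a given mean relative to a
Gaussian the exponential tilt has the least entropy.

Since `t` is fixed, time is never differentiated and `ν_t` enters only as `∫ P_t(·) dν`; in
particular no log-Sobolev inequality for `ν_t` is used. The bound for `Q_t` follows by testing the
dual inequality against truncations of `(Q_t φ)^(q - 1)` (`lintegral_heatAdjointENN_rpow_le`), and
the Rényi bound by applying it to `φ = dμ/dν`, for which `Q_t φ = dμ_t/dν_t`.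
-/

/-! ### The Gaussian density -/

section

variable {d : ℕ}

/-- The centered Gaussian measure `γ_t` with covariance `t I`. -/
noncomputable abbrev heatGaussian (d : ℕ) (t : ℝ) : Measure (EuclideanSpace ℝ (Fin d)) :=
  multivariateGaussian 0 (t • (1 : Matrix (Fin d) (Fin d) ℝ))

lemma heatKernel_pos {t : ℝ} (ht : 0 < t) (z : EuclideanSpace ℝ (Fin d)) : 0 < heatKernel t z := by
  unfold heatKernel; positivity

lemma continuous_heatKernel (t : ℝ) :
    Continuous (heatKernel t : EuclideanSpace ℝ (Fin d) → ℝ) := by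
  unfold heatKernel; fun_prop

lemma integrable_exp_neg_mul_sq_norm {b : ℝ} (hb : 0 < b) :
    Integrable (fun z : EuclideanSpace ℝ (Fin d) => Real.exp (-b * ‖z‖ ^ 2)) := by
  have := (GaussianFourier.integrable_cexp_neg_mul_sq_norm_add (V := EuclideanSpace ℝ (Fin d))
    (b := b) (by simpa using hb) 0 0).norm
  refine this.congr (ae_of_all _ fun z => ?_)
  simp [Complex.norm_exp, ← Complex.ofReal_pow]

lemma integrable_heatKernel {t : ℝ} (ht : 0 < t) :
    Integrable (heatKernel t : EuclideanSpace ℝ (Fin d) → ℝ) := by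
  have := (integrable_exp_neg_mul_sq_norm (d := d) (b := 1 / (2 * t)) (by positivity)).const_mul
    ((2 * Real.pi * t) ^ (-(d : ℝ) / 2))
  refine this.congr (ae_of_all _ fun z => ?_)
  simp only [heatKernel]
  congr 2; ring

lemma integral_heatKernel {t : ℝ} (ht : 0 < t) :
    ∫ z : EuclideanSpace ℝ (Fin d), heatKernel t z = 1 := by
  have h := GaussianFourier.integral_rexp_neg_mul_sq_norm (V := EuclideanSpace ℝ (Fin d))
    (b := 1 / (2 * t)) (by positivity)
  have e : (heatKernel t : EuclideanSpace ℝ (Fin d) → ℝ) =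
      fun z => (2 * Real.pi * t) ^ (-(d : ℝ) / 2) * Real.exp (-(1 / (2 * t)) * ‖z‖ ^ 2) := by
    funext z; simp only [heatKernel]; congr 2; ring
  rw [e, integral_const_mul, h, finrank_euclideanSpace_fin,
    show Real.pi / (1 / (2 * t)) = 2 * Real.pi * t by field_simp, ← Real.rpow_add (by positivity)]
  simp [neg_div]

/-- The measure with density `heatKernel t` is the Gaussian used in `heatFlow`: both have the same
characteristic function. -/
lemma heatGaussian_eq_withDensity {t : ℝ} (ht : 0 < t) :
    heatGaussian d t =
      volume.withDensity fun z => ENNReal.ofReal (heatKernel t z) := by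
  have hprob : IsProbabilityMeasure ((volume : Measure (EuclideanSpace ℝ (Fin d))).withDensity
      fun z => ENNReal.ofReal (heatKernel t z)) := by
    constructor
    rw [withDensity_apply _ MeasurableSet.univ, setLIntegral_univ,
      ← ofReal_integral_eq_lintegral_ofReal (integrable_heatKernel ht)
        (ae_of_all _ fun z => (heatKernel_pos ht z).le), integral_heatKernel ht]
    simp
  have hpsd : (t • (1 : Matrix (Fin d) (Fin d) ℝ)).PosSemidef := Matrix.PosSemidef.one.smul ht.le
  refine Measure.ext_of_charFun ?_
  funext w
  rw [heatGaussian, charFun_multivariateGaussian hpsd, charFun_apply,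
    integral_withDensity_eq_integral_toReal_smul
      ((continuous_heatKernel t).measurable.ennreal_ofReal) (by simp)]
  have hb : 0 < ((1 / (2 * t) : ℝ) : ℂ).re := by rw [Complex.ofReal_re]; positivity
  have h := GaussianFourier.integral_cexp_neg_mul_sq_norm_add (V := EuclideanSpace ℝ (Fin d))
    hb Complex.I w
  have e : ∀ z : EuclideanSpace ℝ (Fin d),
      (ENNReal.ofReal (heatKernel t z)).toReal • Complex.exp ((inner ℝ z w : ℝ) * Complex.I) =
      (((2 * Real.pi * t) ^ (-(d : ℝ) / 2) : ℝ) : ℂ) *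
        Complex.exp (-((1 / (2 * t) : ℝ) : ℂ) * ‖z‖ ^ 2 + Complex.I * (inner ℝ w z : ℝ)) := by
    intro z
    rw [ENNReal.toReal_ofReal (heatKernel_pos ht z).le, Complex.exp_add, heatKernel,
      Complex.real_smul, Complex.ofReal_mul, mul_assoc, real_inner_comm, mul_comm Complex.I]
    congr 2
    rw [Complex.ofReal_exp]
    congr 1
    push_cast
    ring
  simp_rw [e]
  rw [integral_const_mul, h, finrank_euclideanSpace_fin, ← mul_assoc]
  have h1 : (((2 * Real.pi * t) ^ (-(d : ℝ) / 2) : ℝ) : ℂ) *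
      (Real.pi / ((1 / (2 * t) : ℝ) : ℂ)) ^ ((d : ℂ) / 2) = 1 := by
    have : (Real.pi / ((1 / (2 * t) : ℝ) : ℂ)) ^ ((d : ℂ) / 2) =
        (((2 * Real.pi * t) ^ ((d : ℝ) / 2) : ℝ) : ℂ) := by
      rw [Complex.ofReal_cpow (by positivity)]
      congr 1
      · push_cast; field_simp
      · push_cast; ring
    rw [this, ← Complex.ofReal_mul, ← Real.rpow_add (by positivity)]
    simp [neg_div]
  rw [h1, one_mul]
  congr 1
  have hw : (w.ofLp ⬝ᵥ (t • (1 : Matrix (Fin d) (Fin d) ℝ)).mulVec w.ofLp : ℝ) = t * ‖w‖ ^ 2 := by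
    rw [Matrix.smul_mulVec, Matrix.one_mulVec, dotProduct_smul, EuclideanSpace.real_norm_sq_eq,
      smul_eq_mul]
    simp [dotProduct, sq]
  rw [hw]
  have : (t : ℂ) ≠ 0 := by exact_mod_cast ht.ne'
  simp only [inner_zero_right, Complex.I_sq]
  push_cast
  field_simp
  ring

lemma heatFlow_zero (π : Measure (EuclideanSpace ℝ (Fin d))) [SFinite π] : heatFlow π 0 = π := by
  unfold heatFlow
  have : multivariateGaussian (0 : EuclideanSpace ℝ (Fin d))
      ((0 : ℝ) • (1 : Matrix (Fin d) (Fin d) ℝ)) = Measure.dirac 0 := by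
    rw [zero_smul]
    refine Measure.ext_of_charFun ?_
    funext w
    rw [charFun_multivariateGaussian Matrix.PosSemidef.zero]
    simp
  rw [this, Measure.conv_dirac_zero]

/-- Change of variables between the Gaussian and its density, with the centre moved to `x`. -/
lemma integral_gaussian_add {F : Type*} [NormedAddCommGroup F] [NormedSpace ℝ F] {t : ℝ}
    (ht : 0 < t) (H : EuclideanSpace ℝ (Fin d) → F) (x : EuclideanSpace ℝ (Fin d)) :
    ∫ z, H (x + z) ∂(heatGaussian d t) =
      ∫ y, heatKernel t (y - x) • H y := by
  rw [heatGaussian_eq_withDensity ht, integral_withDensity_eq_integral_toReal_smul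
      ((continuous_heatKernel t).measurable.ennreal_ofReal) (by simp)]
  rw [← integral_add_left_eq_self (fun y => heatKernel t (y - x) • H y) x]
  simp [ENNReal.toReal_ofReal (heatKernel_pos ht _).le]

lemma lintegral_gaussian_add {t : ℝ} (ht : 0 < t) {H : EuclideanSpace ℝ (Fin d) → ℝ≥0∞}
    (hH : Measurable H) (x : EuclideanSpace ℝ (Fin d)) :
    ∫⁻ z, H (x + z) ∂(heatGaussian d t) =
      ∫⁻ y, ENNReal.ofReal (heatKernel t (y - x)) * H y := by
  rw [heatGaussian_eq_withDensity ht, lintegral_withDensity_eq_lintegral_mul _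
      ((continuous_heatKernel t).measurable.ennreal_ofReal) (by fun_prop)]
  rw [← lintegral_add_left_eq_self (fun y => ENNReal.ofReal (heatKernel t (y - x)) * H y) x]
  simp

/-! ### Gradients of Gaussian averages and the reverse local log-Sobolev inequality -/

lemma hasFDerivAt_heatKernel_sub {t : ℝ} (ht : 0 < t) (y x : EuclideanSpace ℝ (Fin d)) :
    HasFDerivAt (fun x => heatKernel t (y - x))
      (innerSL ℝ ((heatKernel t (y - x) / t) • (y - x))) x := by
  unfold heatKernel
  have h1 : HasFDerivAt (fun x : EuclideanSpace ℝ (Fin d) => y - x)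
      (-ContinuousLinearMap.id ℝ _) x := (hasFDerivAt_id x).const_sub y
  have h2 := (((h1.norm_sq).neg.mul_const (2 * t)⁻¹).exp).const_mul
    ((2 * Real.pi * t) ^ (-(d : ℝ) / 2))
  simp only [← div_eq_mul_inv] at h2
  refine h2.congr_fderiv ?_
  ext w
  simp
  field_simp
  ring

lemma integrable_exp_neg_mul_sq_norm_sub {b : ℝ} (hb : 0 < b) (x : EuclideanSpace ℝ (Fin d)) :
    Integrable (fun z : EuclideanSpace ℝ (Fin d) => Real.exp (-b * ‖z - x‖ ^ 2)) :=
  (integrable_exp_neg_mul_sq_norm hb).comp_sub_right x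

lemma heatKernel_mul_norm_le {t : ℝ} (ht : 0 < t) (z : EuclideanSpace ℝ (Fin d)) :
    heatKernel t z * ‖z‖ ≤
      (2 * Real.pi * t) ^ (-(d : ℝ) / 2) * ((1 + 4 * t) * Real.exp (-‖z‖ ^ 2 / (4 * t))) := by
  unfold heatKernel
  set r := ‖z‖
  have h1 : r ≤ (1 + 4 * t) * Real.exp (r ^ 2 / (4 * t)) := by
    have h2 := Real.add_one_le_exp (r ^ 2 / (4 * t))
    have h3 : r ^ 2 = 4 * t * (r ^ 2 / (4 * t)) := by field_simp
    have h4 : 0 ≤ r ^ 2 / (4 * t) := by positivity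
    nlinarith [sq_nonneg (r - 1)]
  have h5 : Real.exp (-r ^ 2 / (2 * t)) * r ≤ (1 + 4 * t) * Real.exp (-r ^ 2 / (4 * t)) := by
    calc Real.exp (-r ^ 2 / (2 * t)) * r
    _ ≤ Real.exp (-r ^ 2 / (2 * t)) * ((1 + 4 * t) * Real.exp (r ^ 2 / (4 * t))) := by gcongr
    _ = (1 + 4 * t) * (Real.exp (-r ^ 2 / (2 * t)) * Real.exp (r ^ 2 / (4 * t))) := by ring
    _ = _ := by rw [← Real.exp_add]; congr 2; field_simp; norm_num
  rw [mul_assoc]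
  gcongr

/-- Near a given center, the gradient of the heat kernel is dominated by an integrable function
that does not depend on the center. -/
lemma heatKernel_sub_mul_norm_le {t : ℝ} (ht : 0 < t) {x x' : EuclideanSpace ℝ (Fin d)}
    (hx : ‖x' - x‖ ≤ 1) (y : EuclideanSpace ℝ (Fin d)) :
    heatKernel t (y - x') * ‖y - x'‖ ≤ (2 * Real.pi * t) ^ (-(d : ℝ) / 2) * ((1 + 4 * t) *
      (Real.exp (1 / (4 * t)) * Real.exp (-(1 / (8 * t)) * ‖y - x‖ ^ 2))) := by
  refine (heatKernel_mul_norm_le ht _).trans ?_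
  gcongr
  rw [← Real.exp_add]
  gcongr
  have h : ‖y - x‖ ≤ ‖y - x'‖ + ‖x' - x‖ := norm_sub_le_norm_sub_add_norm_sub ..
  have h2 : ‖y - x‖ ^ 2 ≤ 2 * ‖y - x'‖ ^ 2 + 2 := by
    nlinarith [norm_nonneg (y - x), norm_nonneg (y - x'), norm_nonneg (x' - x),
      sq_nonneg (‖y - x'‖ - ‖x' - x‖)]
  rw [show 1 / (4 * t) + -(1 / (8 * t)) * ‖y - x‖ ^ 2 = (1 - ‖y - x‖ ^ 2 / 2) / (4 * t) by
    field_simp; ring]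
  gcongr
  linarith

/-- Gaussian averages of a bounded measurable function are differentiable, with the derivative
falling on the Gaussian weight: `∇P_t H(x) = t⁻¹ ∫ H(x + z) z dγ_t(z)`. -/
lemma hasFDerivAt_gaussian_average {t : ℝ} (ht : 0 < t) {H : EuclideanSpace ℝ (Fin d) → ℝ}
    (hH : Measurable H) {B : ℝ} (hB : ∀ x, |H x| ≤ B) (x : EuclideanSpace ℝ (Fin d)) :
    HasFDerivAt (fun x => ∫ z, H (x + z) ∂(heatGaussian d t))
      (innerSL ℝ (∫ z, (H (x + z) / t) • z ∂(heatGaussian d t))) x := by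
  have hB0 : 0 ≤ B := (abs_nonneg _).trans (hB 0)
  have hK : Measurable (heatKernel t : EuclideanSpace ℝ (Fin d) → ℝ) :=
    (continuous_heatKernel t).measurable
  have hbd : ∀ x', ‖x' - x‖ ≤ 1 → ∀ y : EuclideanSpace ℝ (Fin d),
      ‖(heatKernel t (y - x') / t * H y) • (y - x')‖ ≤
      (2 * Real.pi * t) ^ (-(d : ℝ) / 2) * ((1 + 4 * t) *
      (Real.exp (1 / (4 * t)) * Real.exp (-(1 / (8 * t)) * ‖y - x‖ ^ 2))) * (B / t) := by
    intro x' hx' y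
    have h1 := heatKernel_sub_mul_norm_le ht hx' y
    have h2 := heatKernel_pos ht (y - x')
    rw [norm_smul, norm_mul, Real.norm_eq_abs (H y), norm_div, Real.norm_of_nonneg h2.le,
      Real.norm_of_nonneg ht.le]
    calc heatKernel t (y - x') / t * |H y| * ‖y - x'‖
        = heatKernel t (y - x') * ‖y - x'‖ * (|H y| / t) := by ring
      _ ≤ _ := by gcongr; exact hB y
  have hbi : Integrable fun y : EuclideanSpace ℝ (Fin d) =>
      (2 * Real.pi * t) ^ (-(d : ℝ) / 2) * ((1 + 4 * t) *
      (Real.exp (1 / (4 * t)) * Real.exp (-(1 / (8 * t)) * ‖y - x‖ ^ 2))) * (B / t) :=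
    (((integrable_exp_neg_mul_sq_norm_sub (by positivity) x).const_mul _ |>.const_mul _
      |>.const_mul _).mul_const _)
  have hmeas : ∀ x', AEStronglyMeasurable (fun y : EuclideanSpace ℝ (Fin d) =>
      (heatKernel t (y - x') / t * H y) • (y - x')) volume := fun x' =>
    Measurable.aestronglyMeasurable (by fun_prop)
  have key := hasFDerivAt_integral_of_dominated_of_fderiv_le (𝕜 := ℝ)
    (μ := (volume : Measure (EuclideanSpace ℝ (Fin d))))
    (F := fun x y => heatKernel t (y - x) * H y)
    (F' := fun x y => innerSL ℝ ((heatKernel t (y - x) / t * H y) • (y - x)))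
    (x₀ := x) (Metric.ball_mem_nhds x one_pos)
    (Eventually.of_forall fun x' => Measurable.aestronglyMeasurable (by fun_prop))
    (((integrable_heatKernel ht).comp_sub_right x).mul_bdd
      hH.aestronglyMeasurable (ae_of_all _ hB))
    ((innerSL ℝ).continuous.comp_aestronglyMeasurable (hmeas x))
    (ae_of_all _ fun y x' hx' => by
      rw [innerSL_apply_norm]
      exact hbd x' (by simpa [dist_eq_norm] using (Metric.mem_ball.1 hx').le) y)
    hbi
    (ae_of_all _ fun y x' _ => by
      have := (hasFDerivAt_heatKernel_sub ht y x').mul_const (H y)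
      refine this.congr_fderiv ?_
      ext w; simp; ring)
  have hint : Integrable (fun y : EuclideanSpace ℝ (Fin d) =>
      (heatKernel t (y - x) / t * H y) • (y - x)) :=
    hbi.mono' (hmeas x) (ae_of_all _ fun y => hbd x (by simp) y)
  rw [ContinuousLinearMap.integral_comp_comm _ hint] at key
  have e1 : (fun x => ∫ z, H (x + z) ∂(heatGaussian d t)) =
      fun x => ∫ y, heatKernel t (y - x) * H y := by
    funext x'
    rw [integral_gaussian_add ht]; simp
  have e2 : ∫ z, (H (x + z) / t) • z ∂(heatGaussian d t) =
      ∫ y, (heatKernel t (y - x) / t * H y) • (y - x) := by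
    have := integral_gaussian_add ht (fun y => (H y / t) • (y - x)) x
    simp only [add_sub_cancel_left] at this
    rw [this]
    congr 1; funext y; rw [smul_smul]; congr 1; ring
  rw [e1, e2]
  exact key

lemma integrable_norm_heatGaussian (t : ℝ) :
    Integrable (fun z : EuclideanSpace ℝ (Fin d) => ‖z‖) (heatGaussian d t) :=
  IsGaussian.integrable_id.norm

/-- The exponential tilt `z ↦ exp(⟨λ, z⟩ - t|λ|²/2)` is a probability density for `γ_t`: it moves
the center of the Gaussian to `tλ`. -/
lemma integral_exp_inner_heatGaussian {t : ℝ} (ht : 0 < t) (l : EuclideanSpace ℝ (Fin d)) :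
    Integrable (fun z => Real.exp (inner ℝ l z - t * ‖l‖ ^ 2 / 2)) (heatGaussian d t) ∧
    ∫ z, Real.exp (inner ℝ l z - t * ‖l‖ ^ 2 / 2) ∂(heatGaussian d t) = 1 := by
  have e : ∀ z : EuclideanSpace ℝ (Fin d),
      heatKernel t z * Real.exp (inner ℝ l z - t * ‖l‖ ^ 2 / 2) = heatKernel t (z - t • l) := by
    intro z
    simp only [heatKernel]
    rw [mul_assoc, ← Real.exp_add, norm_sub_sq_real, norm_smul, real_inner_smul_right,
      real_inner_comm, Real.norm_of_nonneg ht.le]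
    congr 2
    field_simp; ring
  have hm := (continuous_heatKernel (d := d) t).measurable.ennreal_ofReal
  constructor
  · rw [heatGaussian_eq_withDensity ht, integrable_withDensity_iff hm (by simp)]
    refine ((integrable_heatKernel ht).comp_sub_right (t • l)).congr (ae_of_all _ fun z => ?_)
    simp only [← e]
    rw [ENNReal.toReal_ofReal (heatKernel_pos ht z).le, mul_comm]
  · have := integral_gaussian_add ht (fun z => Real.exp (inner ℝ l z - t * ‖l‖ ^ 2 / 2)) 0
    simp only [zero_add, sub_zero, smul_eq_mul, e] at this
    rw [this, integral_sub_right_eq_self (heatKernel t) (t • l), integral_heatKernel ht]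

/-- Reverse local logarithmic Sobolev inequality: for a probability density `exp s` with respect to
`γ_t`, with `s` bounded, whose mean is `tλ`, the entropy is at least `t|λ|²/2`. This is the Gibbs
variational principle, tested against the tilt of `γ_t` with the same mean. -/
lemma half_mul_sq_norm_le_integral_exp_mul {t : ℝ} (ht : 0 < t)
    {s : EuclideanSpace ℝ (Fin d) → ℝ} (hs : Measurable s) {B : ℝ} (hB : ∀ z, |s z| ≤ B)
    (hone : ∫ z, Real.exp (s z) ∂(heatGaussian d t) = 1) (l : EuclideanSpace ℝ (Fin d))
    (hl : ∫ z, (Real.exp (s z) / t) • z ∂(heatGaussian d t) = l) :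
    t / 2 * ‖l‖ ^ 2 ≤ ∫ z, Real.exp (s z) * s z ∂(heatGaussian d t) := by
  obtain ⟨hi, h1⟩ := integral_exp_inner_heatGaussian ht l
  have heB : ∀ z, ‖Real.exp (s z)‖ ≤ Real.exp B := fun z => by
    rw [Real.norm_of_nonneg (Real.exp_pos _).le]; gcongr; exact (le_abs_self _).trans (hB z)
  have i1 : Integrable (fun z => Real.exp (s z)) (heatGaussian d t) :=
    Integrable.of_bound hs.exp.aestronglyMeasurable _ (ae_of_all _ heB)
  have i2 : Integrable (fun z => Real.exp (s z) * s z) (heatGaussian d t) :=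
    i1.mul_bdd hs.aestronglyMeasurable (ae_of_all _ hB)
  have i3 : Integrable (fun z => (Real.exp (s z) / t) • z) (heatGaussian d t) := by
    refine Integrable.bdd_smul (C := Real.exp B / t) IsGaussian.integrable_id
      (hs.exp.div_const t).aestronglyMeasurable (ae_of_all _ fun z => ?_)
    rw [norm_div, Real.norm_of_nonneg ht.le]; gcongr; exact heB z
  have i4 : Integrable (fun z => Real.exp (s z) * inner ℝ l z) (heatGaussian d t) := by
    refine ((i3.const_inner l).const_mul t).congr (ae_of_all _ fun z => ?_)
    simp only [real_inner_smul_right]; field_simp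
  have h4 : ∫ z, Real.exp (s z) * inner ℝ l z ∂(heatGaussian d t) = t * ‖l‖ ^ 2 := by
    have h := integral_inner (𝕜 := ℝ) i3 l
    rw [hl, real_inner_self_eq_norm_sq] at h
    rw [← h, ← integral_const_mul]
    congr 1; funext z; simp only [real_inner_smul_right]; field_simp
  -- `e^s (s - ψ) ≥ e^s - e^ψ` with `ψ = ⟨l, z⟩ - t|l|²/2`, which is `e^(ψ - s) ≥ 1 + (ψ - s)`
  have hpt : ∀ z, Real.exp (s z) - Real.exp (inner ℝ l z - t * ‖l‖ ^ 2 / 2) ≤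
      Real.exp (s z) * s z -
        (Real.exp (s z) * inner ℝ l z - Real.exp (s z) * (t * ‖l‖ ^ 2 / 2)) := by
    intro z
    have h := Real.add_one_le_exp (inner ℝ l z - t * ‖l‖ ^ 2 / 2 - s z)
    have h' : Real.exp (inner ℝ l z - t * ‖l‖ ^ 2 / 2) =
        Real.exp (s z) * Real.exp (inner ℝ l z - t * ‖l‖ ^ 2 / 2 - s z) := by
      rw [← Real.exp_add]; congr 1; ring
    rw [h']
    nlinarith [mul_le_mul_of_nonneg_left h (Real.exp_pos (s z)).le]
  have i5 := i1.mul_const (t * ‖l‖ ^ 2 / 2)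
  have := integral_mono (i1.sub hi) (i2.sub (i4.sub i5)) hpt
  simp only [Pi.sub_apply] at this
  rw [integral_sub i1 hi, integral_sub i2 (by exact i4.sub i5), integral_sub i4 i5,
    integral_mul_const, hone, h1, h4] at this
  linarith

/-! ### The log-Sobolev inequality for exponentials -/

lemma gradLength_le_enorm_fderiv {f : EuclideanSpace ℝ (Fin d) → ℝ}
    {f' : EuclideanSpace ℝ (Fin d) →L[ℝ] ℝ} {x : EuclideanSpace ℝ (Fin d)}
    (hf : HasFDerivAt f f' x) : gradLength f x ≤ ‖f'‖ₑ := by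
  refine ENNReal.le_of_forall_pos_le_add fun ε hε _ => ?_
  refine limsup_le_of_le (by isBoundedDefault) ?_
  have h := hf.isLittleO.def (c := (ε : ℝ)) (by exact_mod_cast hε)
  filter_upwards [nhdsWithin_le_nhds h, self_mem_nhdsWithin] with y hy hne
  have hne' : edist y x ≠ 0 := by simpa [edist_eq_zero] using hne
  rw [ENNReal.div_le_iff hne' (edist_ne_top _ _), edist_eq_enorm_sub, edist_eq_enorm_sub]
  have h1 : ‖f y - f x‖ ≤ (‖f'‖ + ε) * ‖y - x‖ := by
    have h2 := f'.le_opNorm (y - x)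
    have h3 := norm_add_le (f y - f x - f' (y - x)) (f' (y - x))
    rw [sub_add_cancel] at h3
    linarith
  have h2 : ‖f y - f x‖₊ ≤ (‖f'‖₊ + ε) * ‖y - x‖₊ := by exact_mod_cast h1
  simp only [enorm_eq_nnnorm]
  exact_mod_cast h2

/-- The infimum defining the log-Sobolev constant is attained, at least for functions of finite
energy. -/
lemma entropy_le_lsiConst {ν : Measure (EuclideanSpace ℝ (Fin d))} (hfin : lsiConst ν < ∞)
    {f : EuclideanSpace ℝ (Fin d) → ℝ} (hf : LocallyLipschitz f) (hf2 : MemLp f 2 ν)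
    (hE : ∫⁻ x, gradLength f x ^ 2 ∂ν ≠ ∞) :
    entropy ν (fun x => f x ^ 2) ≤ 2 * lsiConst ν * ∫⁻ x, gradLength f x ^ 2 ∂ν := by
  rcases eq_or_ne (∫⁻ x, gradLength f x ^ 2 ∂ν) 0 with h0 | h0
  · obtain ⟨C, hC⟩ := iInf_lt_iff.1 hfin
    obtain ⟨hC, -⟩ := iInf_lt_iff.1 hC
    simpa [h0] using hC f hf hf2
  · have h20 : 2 * ∫⁻ x, gradLength f x ^ 2 ∂ν ≠ 0 := mul_ne_zero two_ne_zero h0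
    have h2t : 2 * ∫⁻ x, gradLength f x ^ 2 ∂ν ≠ ∞ := ENNReal.mul_ne_top (by simp) hE
    have : entropy ν (fun x => f x ^ 2) / (2 * ∫⁻ x, gradLength f x ^ 2 ∂ν) ≤ lsiConst ν := by
      refine le_iInf₂ fun C hC => ?_
      rw [ENNReal.div_le_iff h20 h2t]
      calc _ ≤ _ := hC f hf hf2
        _ = _ := by ring
    rw [ENNReal.div_le_iff h20 h2t] at this
    calc _ ≤ _ := this
      _ = _ := by ring

/-- The log-Sobolev inequality applied to `exp (Λ / 2)`. -/
lemma integral_exp_mul_sub_le {ν : Measure (EuclideanSpace ℝ (Fin d))} [IsProbabilityMeasure ν]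
    (hfin : lsiConst ν < ∞) {Λ : EuclideanSpace ℝ (Fin d) → ℝ} (hΛ : Differentiable ℝ Λ)
    {B B' : ℝ} (hB : ∀ x, |Λ x| ≤ B) (hB' : ∀ x, ‖fderiv ℝ Λ x‖ ≤ B') :
    ∫ x, Real.exp (Λ x) * Λ x ∂ν - (∫ x, Real.exp (Λ x) ∂ν) * Real.log (∫ x, Real.exp (Λ x) ∂ν) ≤
      (lsiConst ν).toReal / 2 * ∫ x, Real.exp (Λ x) * ‖fderiv ℝ Λ x‖ ^ 2 ∂ν := by
  have hB0' : 0 ≤ B' := (norm_nonneg _).trans (hB' 0)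
  have hm : Measurable Λ := hΛ.continuous.measurable
  set f : EuclideanSpace ℝ (Fin d) → ℝ := fun x => Real.exp (Λ x / 2) with hf
  have hfd : ∀ x, HasFDerivAt f (Real.exp (Λ x / 2) • ((2 : ℝ)⁻¹ • fderiv ℝ Λ x)) x := by
    intro x
    have h := ((hΛ x).hasFDerivAt.mul_const (2 : ℝ)⁻¹).exp
    simp only [← div_eq_mul_inv] at h
    exact h
  have hsq : ∀ x, f x ^ 2 = Real.exp (Λ x) := fun x => by
    simp only [hf]; rw [sq, ← Real.exp_add]; congr 1; ring
  have heB : ∀ x, Real.exp (Λ x) ≤ Real.exp B := fun x => by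
    gcongr; exact (le_abs_self _).trans (hB x)
  have hfB : ∀ x, f x ≤ Real.exp (B / 2) := fun x => by
    simp only [hf]; gcongr; exact (le_abs_self _).trans (hB x)
  have hlip : LocallyLipschitz f := by
    have : LipschitzWith (Real.exp (B / 2) * (2⁻¹ * B')).toNNReal f := by
      refine lipschitzWith_of_nnnorm_fderiv_le (𝕜 := ℝ) (fun x => (hfd x).differentiableAt)
        fun x => ?_
      rw [(hfd x).fderiv, ← NNReal.coe_le_coe, Real.coe_toNNReal _ (by positivity), coe_nnnorm,
        norm_smul, norm_smul, Real.norm_of_nonneg (Real.exp_pos _).le, norm_inv, Real.norm_ofNat]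
      exact mul_le_mul (hfB x) (by gcongr; exact hB' x) (by positivity) (by positivity)
    exact this.locallyLipschitz
  have hmem : MemLp f 2 ν := MemLp.of_bound (hm.div_const 2).exp.aestronglyMeasurable
    (Real.exp (B / 2)) (ae_of_all _ fun x => by
      rw [Real.norm_of_nonneg (Real.exp_pos _).le]; exact hfB x)
  have i1 : Integrable (fun x => Real.exp (Λ x)) ν :=
    Integrable.of_bound hm.exp.aestronglyMeasurable (Real.exp B) (ae_of_all _ fun x => by
      rw [Real.norm_of_nonneg (Real.exp_pos _).le]; exact heB x)
  have i2 : Integrable (fun x => Real.exp (Λ x) * Λ x) ν :=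
    i1.mul_bdd hm.aestronglyMeasurable (ae_of_all _ hB)
  have i3 : Integrable (fun x => Real.exp (Λ x) * ‖fderiv ℝ Λ x‖ ^ 2) ν := by
    refine i1.mul_bdd (c := B' ^ 2) ((measurable_fderiv ℝ Λ).norm.pow_const 2).aestronglyMeasurable
      (ae_of_all _ fun x => ?_)
    rw [norm_pow, norm_norm]
    gcongr; exact hB' x
  have hI : ∫⁻ x, gradLength f x ^ 2 ∂ν ≤
      ENNReal.ofReal (4⁻¹ * ∫ x, Real.exp (Λ x) * ‖fderiv ℝ Λ x‖ ^ 2 ∂ν) := by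
    rw [← integral_const_mul, ofReal_integral_eq_lintegral_ofReal (i3.const_mul _)
      (ae_of_all _ fun x => by positivity)]
    refine lintegral_mono fun x => ?_
    refine (pow_le_pow_left₀ (by positivity) (gradLength_le_enorm_fderiv (hfd x)) 2).trans ?_
    rw [← ofReal_norm, ← ENNReal.ofReal_pow (norm_nonneg _)]
    refine ENNReal.ofReal_le_ofReal (le_of_eq ?_)
    rw [norm_smul, norm_smul, Real.norm_of_nonneg (Real.exp_pos _).le, norm_inv, Real.norm_ofNat,
      ← hsq x]
    simp only [hf]; ring
  have key := entropy_le_lsiConst hfin hlip hmem (hI.trans_lt ENNReal.ofReal_lt_top).ne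
  simp only [hsq] at key
  rw [entropy, if_pos (by simpa only [Real.log_exp] using i2)] at key
  simp only [Real.log_exp] at key
  have key2 := key.trans (mul_le_mul_right hI _)
  have h2C : 2 * lsiConst ν = ENNReal.ofReal (2 * (lsiConst ν).toReal) := by
    rw [ENNReal.ofReal_mul zero_le_two, ENNReal.ofReal_toReal hfin.ne]; simp
  rw [h2C, ← ENNReal.ofReal_mul (by positivity), ENNReal.ofReal_le_ofReal_iff] at key2
  · linarith
  · have : 0 ≤ ∫ x, Real.exp (Λ x) * ‖fderiv ℝ Λ x‖ ^ 2 ∂ν :=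
      integral_nonneg fun x => by positivity
    positivity

/-! ### The logarithm of the heat semigroup -/

/-- The logarithm of the heat semigroup applied to `exp (b u)`, written as the cumulant generating
function of `u` under the Gaussian centered at `x`. -/
noncomputable def logHeat (t : ℝ) (u : EuclideanSpace ℝ (Fin d) → ℝ) (b : ℝ)
    (x : EuclideanSpace ℝ (Fin d)) : ℝ :=
  cgf (fun z => u (x + z)) (heatGaussian d t) b

/-- The derivative of `logHeat` in the exponent `b`. -/
noncomputable def logHeatDeriv (t : ℝ) (u : EuclideanSpace ℝ (Fin d) → ℝ) (b : ℝ)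
    (x : EuclideanSpace ℝ (Fin d)) : ℝ :=
  (∫ z, u (x + z) * Real.exp (b * u (x + z)) ∂(heatGaussian d t)) /
    mgf (fun z => u (x + z)) (heatGaussian d t) b

section

variable {t : ℝ} {u : EuclideanSpace ℝ (Fin d) → ℝ} {K : ℝ}

lemma integrable_exp_mul_comp_add (hu : Measurable u) (hK : ∀ x, |u x| ≤ K) (b : ℝ)
    (x : EuclideanSpace ℝ (Fin d)) :
    Integrable (fun z => Real.exp (b * u (x + z))) (heatGaussian d t) := by
  refine Integrable.of_bound (Measurable.aestronglyMeasurable (by fun_prop)) (Real.exp (|b| * K))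
    (ae_of_all _ fun z => ?_)
  rw [Real.norm_of_nonneg (Real.exp_pos _).le]
  refine Real.exp_le_exp.2 ((le_abs_self _).trans ?_)
  rw [abs_mul]
  gcongr
  exact hK _

lemma mgf_comp_add_pos (hu : Measurable u) (hK : ∀ x, |u x| ≤ K) (b : ℝ)
    (x : EuclideanSpace ℝ (Fin d)) :
    0 < mgf (fun z => u (x + z)) (heatGaussian d t) b :=
  mgf_pos (integrable_exp_mul_comp_add hu hK b x)

lemma exp_logHeat (hu : Measurable u) (hK : ∀ x, |u x| ≤ K) (b : ℝ)
    (x : EuclideanSpace ℝ (Fin d)) :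
    Real.exp (logHeat t u b x) = ∫ z, Real.exp (b * u (x + z)) ∂(heatGaussian d t) := by
  rw [logHeat, cgf, Real.exp_log (mgf_comp_add_pos hu hK b x), mgf]

lemma abs_logHeat_le (hu : Measurable u) (hK : ∀ x, |u x| ≤ K) (b : ℝ)
    (x : EuclideanSpace ℝ (Fin d)) : |logHeat t u b x| ≤ |b| * K := by
  have hbd : ∀ y, |b * u y| ≤ |b| * K := fun y => by rw [abs_mul]; gcongr; exact hK y
  have hi := integrable_exp_mul_comp_add (t := t) hu hK b x
  rw [abs_le]
  constructor
  · rw [← Real.exp_le_exp, exp_logHeat hu hK]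
    have := integral_mono (integrable_const (Real.exp (-(|b| * K)))) hi fun z =>
      Real.exp_le_exp.2 (abs_le.1 (hbd (x + z))).1
    simpa using this
  · rw [← Real.exp_le_exp, exp_logHeat hu hK]
    have := integral_mono hi (integrable_const (Real.exp (|b| * K))) fun z =>
      Real.exp_le_exp.2 (abs_le.1 (hbd (x + z))).2
    simpa using this

lemma hasDerivAt_logHeat (hu : Measurable u) (hK : ∀ x, |u x| ≤ K) (b : ℝ)
    (x : EuclideanSpace ℝ (Fin d)) :
    HasDerivAt (fun b => logHeat t u b x) (logHeatDeriv t u b x) b := by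
  have h : integrableExpSet (fun z => u (x + z)) (heatGaussian d t) = Set.univ :=
    Set.eq_univ_of_forall fun b => integrable_exp_mul_comp_add hu hK b x
  exact (hasDerivAt_mgf (by simp [h])).log (mgf_comp_add_pos hu hK b x).ne'

lemma abs_logHeatDeriv_le (hu : Measurable u) (hK : ∀ x, |u x| ≤ K) (b : ℝ)
    (x : EuclideanSpace ℝ (Fin d)) : |logHeatDeriv t u b x| ≤ K := by
  have hi := integrable_exp_mul_comp_add (t := t) hu hK b x
  rw [logHeatDeriv, abs_div, abs_of_pos (mgf_comp_add_pos hu hK b x),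
    div_le_iff₀ (mgf_comp_add_pos hu hK b x), mgf, ← integral_const_mul, ← Real.norm_eq_abs]
  refine norm_integral_le_of_norm_le (hi.const_mul K) (ae_of_all _ fun z => ?_)
  rw [norm_mul, Real.norm_of_nonneg (Real.exp_pos _).le]
  gcongr
  exact hK _

lemma measurable_logHeatDeriv (hu : Measurable u) (b : ℝ) :
    Measurable (logHeatDeriv t u b) := by
  unfold logHeatDeriv mgf
  refine Measurable.div ?_ ?_
  · have : Measurable (Function.uncurry fun x z : EuclideanSpace ℝ (Fin d) =>
        u (x + z) * Real.exp (b * u (x + z))) := by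
      unfold Function.uncurry; fun_prop
    exact (this.stronglyMeasurable.integral_prod_right (ν := heatGaussian d t)).measurable
  · have : Measurable (Function.uncurry fun x z : EuclideanSpace ℝ (Fin d) =>
        Real.exp (b * u (x + z))) := by
      unfold Function.uncurry; fun_prop
    exact (this.stronglyMeasurable.integral_prod_right (ν := heatGaussian d t)).measurable

/-- The gradient of `logHeat` is `t⁻¹` times the mean of the Gaussian tilted by
`exp (b u(x + ·))`. -/
lemma hasFDerivAt_logHeat (ht : 0 < t) (hu : Measurable u) (hK : ∀ x, |u x| ≤ K) (b : ℝ)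
    (x : EuclideanSpace ℝ (Fin d)) :
    HasFDerivAt (logHeat t u b)
      (innerSL ℝ (∫ z, (Real.exp (b * u (x + z) - logHeat t u b x) / t) • z ∂(heatGaussian d t)))
      x := by
  have h := hasFDerivAt_gaussian_average (H := fun y => Real.exp (b * u y)) ht (by fun_prop)
    (B := Real.exp (|b| * K)) (fun y => by
      rw [abs_of_pos (Real.exp_pos _)]
      refine Real.exp_le_exp.2 ((le_abs_self _).trans ?_)
      rw [abs_mul]
      gcongr
      exact hK _) x
  have h2 := h.log (mgf_comp_add_pos (t := t) hu hK b x).ne'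
  refine h2.congr_fderiv ?_
  rw [← exp_logHeat hu hK, ← map_smul, ← integral_smul]
  congr 2
  funext z
  rw [smul_smul, Real.exp_sub]
  congr 1
  ring

lemma norm_fderiv_logHeat_le (ht : 0 < t) (hu : Measurable u) (hK : ∀ x, |u x| ≤ K) (b : ℝ)
    (x : EuclideanSpace ℝ (Fin d)) :
    ‖fderiv ℝ (logHeat t u b) x‖ ≤
      ∫ z, Real.exp (2 * (|b| * K)) / t * ‖z‖ ∂(heatGaussian d t) := by
  rw [(hasFDerivAt_logHeat ht hu hK b x).fderiv, innerSL_apply_norm]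
  refine norm_integral_le_of_norm_le ((integrable_norm_heatGaussian t).const_mul _)
    (ae_of_all _ fun z => ?_)
  rw [norm_smul, norm_div, Real.norm_of_nonneg ht.le, Real.norm_of_nonneg (Real.exp_pos _).le]
  gcongr
  have h1 := abs_le.1 (abs_logHeat_le (t := t) hu hK b x)
  have h2 : b * u (x + z) ≤ |b| * K := by
    refine (le_abs_self _).trans ?_
    rw [abs_mul]
    gcongr
    exact hK _
  linarith

/-- The reverse local log-Sobolev inequality in terms of `logHeat`. -/
lemma half_mul_sq_norm_fderiv_logHeat_le (ht : 0 < t) (hu : Measurable u) (hK : ∀ x, |u x| ≤ K)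
    (b : ℝ) (x : EuclideanSpace ℝ (Fin d)) :
    t / 2 * ‖fderiv ℝ (logHeat t u b) x‖ ^ 2 ≤ b * logHeatDeriv t u b x - logHeat t u b x := by
  rw [(hasFDerivAt_logHeat ht hu hK b x).fderiv, innerSL_apply_norm]
  have hi := integrable_exp_mul_comp_add (t := t) hu hK b x
  have hpos := mgf_comp_add_pos (t := t) hu hK b x
  have hL : Real.exp (logHeat t u b x) = mgf (fun z => u (x + z)) (heatGaussian d t) b :=
    exp_logHeat hu hK b x
  have hsplit : ∀ z, Real.exp (b * u (x + z) - logHeat t u b x) =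
      Real.exp (b * u (x + z)) / mgf (fun z => u (x + z)) (heatGaussian d t) b := fun z => by
    rw [Real.exp_sub, hL]
  refine (half_mul_sq_norm_le_integral_exp_mul ht
    (s := fun z => b * u (x + z) - logHeat t u b x) (by fun_prop)
    (B := |b| * K + |b| * K) (fun z => ?_) ?_ _ rfl).trans (le_of_eq ?_)
  · refine (abs_sub _ _).trans (add_le_add ?_ (abs_logHeat_le hu hK b x))
    rw [abs_mul]
    gcongr
    exact hK _
  · simp only [hsplit]
    rw [integral_div]
    exact div_self hpos.ne'
  · have i1 : Integrable (fun z => u (x + z) * Real.exp (b * u (x + z))) (heatGaussian d t) :=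
      hi.bdd_mul (Measurable.aestronglyMeasurable (by fun_prop)) (ae_of_all _ fun z => hK (x + z))
    have e : ∀ z, Real.exp (b * u (x + z) - logHeat t u b x) * (b * u (x + z) - logHeat t u b x) =
        b * (u (x + z) * Real.exp (b * u (x + z)) / mgf (fun z => u (x + z)) (heatGaussian d t) b) -
        logHeat t u b x * (Real.exp (b * u (x + z)) /
          mgf (fun z => u (x + z)) (heatGaussian d t) b) := fun z => by
      rw [hsplit]; ring
    simp only [e]
    rw [integral_sub ((i1.div_const _).const_mul _) ((hi.div_const _).const_mul _),
      integral_const_mul, integral_const_mul, integral_div, integral_div, logHeatDeriv]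
    rw [show ∫ z, Real.exp (b * u (x + z)) ∂(heatGaussian d t) =
      mgf (fun z => u (x + z)) (heatGaussian d t) b from rfl, div_self hpos.ne', mul_one]

lemma differentiable_logHeat (ht : 0 < t) (hu : Measurable u) (hK : ∀ x, |u x| ≤ K) (b : ℝ) :
    Differentiable ℝ (logHeat t u b) :=
  fun x => (hasFDerivAt_logHeat ht hu hK b x).differentiableAt

end

/-! ### Monotone interpolation between the two norms -/

section

variable {t : ℝ} {u : EuclideanSpace ℝ (Fin d) → ℝ} {K : ℝ}

/-- Differentiation under the integral sign of `∫ exp ((a(b) / b) logHeat t u b) dν` along the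
segment `a(b) = P - c (b - 1)`. -/
lemma hasDerivAt_integral_exp_logHeat (ht : 0 < t) (hu : Measurable u) (hK : ∀ x, |u x| ≤ K)
    (ν : Measure (EuclideanSpace ℝ (Fin d))) [IsProbabilityMeasure ν] (P c : ℝ) {b : ℝ}
    (hb : 0 < b) :
    Integrable (fun x => Real.exp ((P - c * (b - 1)) / b * logHeat t u b x) *
        ((-c * b - (P - c * (b - 1))) / b ^ 2 * logHeat t u b x +
          (P - c * (b - 1)) / b * logHeatDeriv t u b x)) ν ∧
    HasDerivAt (fun b => ∫ x, Real.exp ((P - c * (b - 1)) / b * logHeat t u b x) ∂ν)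
      (∫ x, Real.exp ((P - c * (b - 1)) / b * logHeat t u b x) *
        ((-c * b - (P - c * (b - 1))) / b ^ 2 * logHeat t u b x +
          (P - c * (b - 1)) / b * logHeatDeriv t u b x) ∂ν) b := by
  have hK0 : 0 ≤ K := (abs_nonneg _).trans (hK 0)
  set R : ℝ := |P| + |c| * (2 * b + 1) with hR
  have hR0 : 0 ≤ R := by positivity
  have hs : ∀ s ∈ Metric.ball b (b / 2), b / 2 < s ∧ s < 2 * b := fun s hs => by
    rw [Metric.mem_ball, Real.dist_eq, abs_lt] at hs
    constructor <;> linarith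
  have haR : ∀ s, b / 2 < s → s < 2 * b → |P - c * (s - 1)| ≤ R := fun s h1 h2 => by
    refine (abs_sub _ _).trans ?_
    rw [abs_mul]
    have : |s - 1| ≤ 2 * b + 1 := by rw [abs_le]; constructor <;> linarith
    rw [hR]
    gcongr
  have hmeas : ∀ s, Measurable (logHeat t u s) := fun s =>
    (differentiable_logHeat ht hu hK s).continuous.measurable
  have hdmeas : ∀ s, Measurable (logHeatDeriv t u s) := fun s => measurable_logHeatDeriv hu s
  have hexp : ∀ s, b / 2 < s → s < 2 * b → ∀ x,
      Real.exp ((P - c * (s - 1)) / s * logHeat t u s x) ≤ Real.exp (R * K) := fun s h1 h2 x => by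
    have hs0 : 0 < s := by linarith
    refine Real.exp_le_exp.2 ((le_abs_self _).trans ?_)
    rw [abs_mul, abs_div, abs_of_pos hs0]
    calc |P - c * (s - 1)| / s * |logHeat t u s x| ≤ R / s * (s * K) := by
          gcongr
          · exact haR s h1 h2
          · exact (abs_logHeat_le hu hK s x).trans_eq (by rw [abs_of_pos hs0])
      _ = R * K := by field_simp
  refine hasDerivAt_integral_of_dominated_loc_of_deriv_le (μ := ν)
    (F := fun s x => Real.exp ((P - c * (s - 1)) / s * logHeat t u s x))
    (F' := fun s x => Real.exp ((P - c * (s - 1)) / s * logHeat t u s x) *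
      ((-c * s - (P - c * (s - 1))) / s ^ 2 * logHeat t u s x +
        (P - c * (s - 1)) / s * logHeatDeriv t u s x))
    (bound := fun _ => Real.exp (R * K) * ((|c| * (2 * b) + R) / (b / 2) * K + R / (b / 2) * K))
    (Metric.ball_mem_nhds b (half_pos hb))
    (Eventually.of_forall fun s => ((hmeas s).const_mul _).exp.aestronglyMeasurable)
    ?_ ?_ ?_ (integrable_const _) ?_
  · refine Integrable.of_bound ((hmeas b).const_mul _).exp.aestronglyMeasurable (Real.exp (R * K))
      (ae_of_all _ fun x => ?_)
    rw [Real.norm_of_nonneg (Real.exp_pos _).le]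
    exact hexp b (by linarith) (by linarith) x
  · exact ((((hmeas b).const_mul _).exp).mul
      (((hmeas b).const_mul _).add ((hdmeas b).const_mul _))).aestronglyMeasurable
  · refine ae_of_all _ fun x s hsb => ?_
    obtain ⟨h1, h2⟩ := hs s hsb
    have hs0 : 0 < s := by linarith
    rw [norm_mul, Real.norm_of_nonneg (Real.exp_pos _).le]
    refine mul_le_mul (hexp s h1 h2 x) ?_ (norm_nonneg _) (Real.exp_pos _).le
    refine (norm_add_le _ _).trans (add_le_add ?_ ?_)
    · rw [norm_mul, norm_div, norm_pow, Real.norm_eq_abs, Real.norm_eq_abs, Real.norm_eq_abs,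
        abs_of_pos hs0]
      have h3 : |-c * s - (P - c * (s - 1))| ≤ |c| * (2 * b) + R := by
        refine (abs_sub _ _).trans (add_le_add ?_ (haR s h1 h2))
        rw [abs_mul, abs_neg, abs_of_pos hs0]
        gcongr
      calc |-c * s - (P - c * (s - 1))| / s ^ 2 * |logHeat t u s x|
          ≤ (|c| * (2 * b) + R) / s ^ 2 * (s * K) := by
            gcongr
            exact (abs_logHeat_le hu hK s x).trans_eq (by rw [abs_of_pos hs0])
        _ = (|c| * (2 * b) + R) / s * K := by field_simp
        _ ≤ _ := by gcongr
    · rw [norm_mul, norm_div, Real.norm_eq_abs, Real.norm_eq_abs, Real.norm_eq_abs,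
        abs_of_pos hs0]
      gcongr
      · exact haR s h1 h2
      · exact abs_logHeatDeriv_le hu hK s x
  · refine ae_of_all _ fun x s hsb => ?_
    obtain ⟨h1, h2⟩ := hs s hsb
    have hs0 : s ≠ 0 := by linarith
    have ha : HasDerivAt (fun s : ℝ => (P - c * (s - 1)) / s)
        ((-c * s - (P - c * (s - 1))) / s ^ 2) s := by
      have h := ((((hasDerivAt_id s).sub_const 1).const_mul c).const_sub P).div
        (hasDerivAt_id s) hs0
      refine h.congr_deriv ?_
      simp
    exact (ha.mul (hasDerivAt_logHeat hu hK s x)).exp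

/-- The combination of the log-Sobolev inequality for `ν` and the reverse local log-Sobolev
inequality for the Gaussian that makes the interpolation monotone: along `a' = -t / C`, the loss
`a' Ent` is compensated by the Gaussian entropy production. -/
lemma entropy_balance (ht : 0 < t) (hu : Measurable u) (hK : ∀ x, |u x| ≤ K)
    (ν : Measure (EuclideanSpace ℝ (Fin d))) [IsProbabilityMeasure ν]
    (hpos : 0 < lsiConst ν) (hfin : lsiConst ν < ∞) (P : ℝ) {b c : ℝ} (hb : 0 < b)
    (hc : c = t / (lsiConst ν).toReal) :
    0 ≤ (P - c * (b - 1)) * (∫ x, Real.exp ((P - c * (b - 1)) / b * logHeat t u b x) *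
        ((-c * b - (P - c * (b - 1))) / b ^ 2 * logHeat t u b x +
          (P - c * (b - 1)) / b * logHeatDeriv t u b x) ∂ν) +
      c * ((∫ x, Real.exp ((P - c * (b - 1)) / b * logHeat t u b x) ∂ν) *
        Real.log (∫ x, Real.exp ((P - c * (b - 1)) / b * logHeat t u b x) ∂ν)) := by
  obtain ⟨hint, -⟩ := hasDerivAt_integral_exp_logHeat ht hu hK ν P c hb
  have hC : 0 < (lsiConst ν).toReal := ENNReal.toReal_pos hpos.ne' hfin.ne
  set C := (lsiConst ν).toReal
  set a := P - c * (b - 1)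
  have hdiff := differentiable_logHeat ht hu hK b
  set Λ : EuclideanSpace ℝ (Fin d) → ℝ := fun x => a / b * logHeat t u b x with hΛ
  have hΛd : Differentiable ℝ Λ := hdiff.const_mul _
  have hfd : ∀ x, fderiv ℝ Λ x = (a / b) • fderiv ℝ (logHeat t u b) x := fun x =>
    ((hdiff x).hasFDerivAt.const_mul (a / b)).fderiv
  have hΛB : ∀ x, |Λ x| ≤ |a / b| * (|b| * K) := fun x => by
    simp only [hΛ]
    rw [abs_mul]
    gcongr
    exact abs_logHeat_le hu hK b x
  have hΛB' : ∀ x, ‖fderiv ℝ Λ x‖ ≤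
      ‖a / b‖ * ∫ z, Real.exp (2 * (|b| * K)) / t * ‖z‖ ∂(heatGaussian d t) := fun x => by
    rw [hfd, norm_smul]
    gcongr
    exact norm_fderiv_logHeat_le ht hu hK b x
  have hlsi := integral_exp_mul_sub_le hfin hΛd hΛB hΛB'
  have i1 : Integrable (fun x => Real.exp (Λ x)) ν :=
    Integrable.of_bound hΛd.continuous.measurable.exp.aestronglyMeasurable
      (Real.exp (|a / b| * (|b| * K))) (ae_of_all _ fun x => by
        rw [Real.norm_of_nonneg (Real.exp_pos _).le]
        gcongr
        exact (le_abs_self _).trans (hΛB x))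
  have i2 : Integrable (fun x => Real.exp (Λ x) * Λ x) ν :=
    i1.mul_bdd hΛd.continuous.measurable.aestronglyMeasurable (ae_of_all _ hΛB)
  have i3 : Integrable (fun x => Real.exp (Λ x) * ‖fderiv ℝ Λ x‖ ^ 2) ν := by
    refine i1.mul_bdd (c := (‖a / b‖ * ∫ z, Real.exp (2 * (|b| * K)) / t * ‖z‖
      ∂(heatGaussian d t)) ^ 2) ((measurable_fderiv ℝ Λ).norm.pow_const 2).aestronglyMeasurable
      (ae_of_all _ fun x => ?_)
    rw [norm_pow, norm_norm]
    gcongr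
    exact hΛB' x
  -- With `a' = -c`, `∂_b Λ = (a' / a) Λ + (a / b²) (b ∂_b ℓ - ℓ)` for `ℓ = logHeat t u b`, and the
  -- last bracket is at least `(t / 2) |∇ℓ|²` by the reverse local log-Sobolev inequality.
  have hpt : ∀ x, -c * (Real.exp (Λ x) * Λ x) + t / 2 * (Real.exp (Λ x) * ‖fderiv ℝ Λ x‖ ^ 2) ≤
      a * (Real.exp (Λ x) * ((-c * b - a) / b ^ 2 * logHeat t u b x +
        a / b * logHeatDeriv t u b x)) := by
    intro x
    have h := half_mul_sq_norm_fderiv_logHeat_le ht hu hK b x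
    have h1 : a * (Real.exp (Λ x) * ((-c * b - a) / b ^ 2 * logHeat t u b x +
        a / b * logHeatDeriv t u b x)) = -c * (Real.exp (Λ x) * Λ x) +
        Real.exp (Λ x) * ((a / b) ^ 2 * (b * logHeatDeriv t u b x - logHeat t u b x)) := by
      simp only [hΛ]; field_simp; ring
    have h2 : t / 2 * (Real.exp (Λ x) * ‖fderiv ℝ Λ x‖ ^ 2) = Real.exp (Λ x) *
        ((a / b) ^ 2 * (t / 2 * ‖fderiv ℝ (logHeat t u b) x‖ ^ 2)) := by
      rw [hfd, norm_smul, mul_pow, Real.norm_eq_abs, sq_abs]; ring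
    rw [h1, h2]
    gcongr
  have h := integral_mono ((i2.const_mul (-c)).add (i3.const_mul (t / 2))) (hint.const_mul a) hpt
  simp only [Pi.add_apply] at h
  rw [integral_add (i2.const_mul _) (i3.const_mul _), integral_const_mul, integral_const_mul,
    integral_const_mul] at h
  have hc0 : 0 ≤ c := by rw [hc]; positivity
  have hcC : c * (C / 2) = t / 2 := by rw [hc]; field_simp
  have h3 := mul_le_mul_of_nonneg_left hlsi hc0
  rw [← mul_assoc, hcC, mul_sub] at h3
  linarith

/-- Hypercontractivity in dual form for `exp u`. The exponents `(b, a(b))` run along the segment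
from `(1, P)` to `(Q, Q)`, and `a(b)⁻¹ log ∫ (P_t exp (b u))^(a(b) / b) dν` is nondecreasing. -/
lemma log_integral_exp_logHeat_le (ht : 0 < t) (hu : Measurable u) (hK : ∀ x, |u x| ≤ K)
    (ν : Measure (EuclideanSpace ℝ (Fin d))) [IsProbabilityMeasure ν]
    (hpos : 0 < lsiConst ν) (hfin : lsiConst ν < ∞) {P Q : ℝ} (hQ : 1 ≤ Q)
    (hPQ : P - 1 = (1 + t / (lsiConst ν).toReal) * (Q - 1)) :
    P⁻¹ * Real.log (∫ x, Real.exp (P * logHeat t u 1 x) ∂ν) ≤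
      Q⁻¹ * Real.log (∫ x, Real.exp (logHeat t u Q x) ∂ν) := by
  have hC : 0 < (lsiConst ν).toReal := ENNReal.toReal_pos hpos.ne' hfin.ne
  obtain ⟨c, hc⟩ : ∃ c, c = t / (lsiConst ν).toReal := ⟨_, rfl⟩
  have hc0 : 0 < c := by rw [hc]; positivity
  rw [← hc] at hPQ
  -- The exponent `a(b) = P - c (b - 1)` decreases from `P` at `b = 1` to `Q` at `b = Q`.
  set A : ℝ → ℝ := fun b => ∫ x, Real.exp ((P - c * (b - 1)) / b * logHeat t u b x) ∂ν with hA
  have ha : ∀ b, b ≤ Q → 0 < P - c * (b - 1) := fun b hb => by nlinarith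
  have hApos : ∀ b, 0 < A b := fun b => by
    refine integral_exp_pos ?_
    refine Integrable.of_bound (((differentiable_logHeat ht hu hK b).continuous.measurable.const_mul
      _).exp.aestronglyMeasurable) (Real.exp (|(P - c * (b - 1)) / b| * (|b| * K)))
      (ae_of_all _ fun x => ?_)
    rw [Real.norm_of_nonneg (Real.exp_pos _).le]
    refine Real.exp_le_exp.2 ((le_abs_self _).trans ?_)
    rw [abs_mul]
    gcongr
    exact abs_logHeat_le hu hK b x
  set A' : ℝ → ℝ := fun b => ∫ x, Real.exp ((P - c * (b - 1)) / b * logHeat t u b x) *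
        ((-c * b - (P - c * (b - 1))) / b ^ 2 * logHeat t u b x +
          (P - c * (b - 1)) / b * logHeatDeriv t u b x) ∂ν with hA'
  have hder : ∀ b, 0 < b → b ≤ Q → HasDerivAt (fun b => Real.log (A b) / (P - c * (b - 1)))
      ((A' b / A b * (P - c * (b - 1)) - Real.log (A b) * (-c)) / (P - c * (b - 1)) ^ 2) b := by
    intro b hb hbQ
    have h1 := (hasDerivAt_integral_exp_logHeat ht hu hK ν P c hb).2.log (hApos b).ne'
    have h2 : HasDerivAt (fun s : ℝ => P - c * (s - 1)) (-c) b := by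
      simpa using (((hasDerivAt_id b).sub_const 1).const_mul c).const_sub P
    exact h1.div h2 (ha b hbQ).ne'
  have hmono : MonotoneOn (fun b => Real.log (A b) / (P - c * (b - 1))) (Set.Icc 1 Q) := by
    refine monotoneOn_of_deriv_nonneg (convex_Icc 1 Q)
      (fun b hb => (hder b (by linarith [hb.1]) hb.2).continuousAt.continuousWithinAt)
      (fun b hb => ?_) fun b hb => ?_
    · rw [interior_Icc] at hb
      exact (hder b (by linarith [hb.1]) hb.2.le).differentiableAt.differentiableWithinAt
    · rw [interior_Icc] at hb
      have hb0 : 0 < b := by linarith [hb.1]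
      rw [(hder b hb0 hb.2.le).deriv]
      have hbal := entropy_balance ht hu hK ν hpos hfin P hb0 hc
      change 0 ≤ (P - c * (b - 1)) * A' b + c * (A b * Real.log (A b)) at hbal
      refine div_nonneg ?_ (sq_nonneg _)
      have : A' b / A b * (P - c * (b - 1)) - Real.log (A b) * (-c) =
          ((P - c * (b - 1)) * A' b + c * (A b * Real.log (A b))) / A b := by
        have := (hApos b).ne'
        field_simp; ring
      rw [this]
      exact div_nonneg hbal (hApos b).le
  have h := hmono (Set.left_mem_Icc.2 hQ) (Set.right_mem_Icc.2 hQ) hQ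
  have hQa : P - c * (Q - 1) = Q := by linarith
  have hQ0 : Q ≠ 0 := by linarith
  simp only [hA, hQa, sub_self, mul_zero, sub_zero, div_one, div_self hQ0, one_mul] at h
  simpa only [div_eq_inv_mul] using h

end

/-! ### Duality -/

instance isProbabilityMeasure_heatFlow (π : Measure (EuclideanSpace ℝ (Fin d)))
    [IsProbabilityMeasure π] (t : ℝ) : IsProbabilityMeasure (heatFlow π t) := by
  unfold heatFlow; infer_instance

/-- Hypercontractivity in dual form: `P_t` maps `L^Q(ν_t)` to `L^P(ν)` with norm at most one. -/
lemma lintegral_heat_rpow_le {t : ℝ} (ht : 0 < t) (ν : Measure (EuclideanSpace ℝ (Fin d)))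
    [IsProbabilityMeasure ν] (hpos : 0 < lsiConst ν) (hfin : lsiConst ν < ∞) {P Q : ℝ}
    (hQ : 1 < Q) (hPQ : P - 1 = (1 + t / (lsiConst ν).toReal) * (Q - 1))
    {h : EuclideanSpace ℝ (Fin d) → ℝ} (hh : Measurable h) {ε M : ℝ} (hε : 0 < ε)
    (hεh : ∀ x, ε ≤ h x) (hhM : ∀ x, h x ≤ M) :
    (∫⁻ x, (∫⁻ z, ENNReal.ofReal (h (x + z)) ∂(heatGaussian d t)) ^ P ∂ν) ^ (1 / P) ≤
      (∫⁻ y, ENNReal.ofReal (h y) ^ Q ∂(heatFlow ν t)) ^ (1 / Q) := by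
  have hC : 0 < (lsiConst ν).toReal := ENNReal.toReal_pos hpos.ne' hfin.ne
  have hP0 : 0 < P := by
    have : 0 < (1 + t / (lsiConst ν).toReal) * (Q - 1) := mul_pos (by positivity) (by linarith)
    linarith
  have hQ0 : 0 < Q := by linarith
  have hh0 : ∀ x, 0 < h x := fun x => hε.trans_le (hεh x)
  set u : EuclideanSpace ℝ (Fin d) → ℝ := fun x => Real.log (h x) with hu_def
  have hu : Measurable u := hh.log
  have hK : ∀ x, |u x| ≤ |Real.log ε| + |Real.log M| := fun x => by
    have h1 := Real.log_le_log hε (hεh x)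
    have h2 := Real.log_le_log (hh0 x) (hhM x)
    rw [abs_le]
    constructor <;> simp only [hu_def] <;>
      linarith [neg_abs_le (Real.log ε), le_abs_self (Real.log M), abs_nonneg (Real.log ε),
        abs_nonneg (Real.log M)]
  -- `∫⁻ exp (b u(x + z)) dγ = exp (logHeat b x)`, as extended nonnegative reals
  have hin : ∀ b x, ∫⁻ z, ENNReal.ofReal (Real.exp (b * u (x + z))) ∂(heatGaussian d t) =
      ENNReal.ofReal (Real.exp (logHeat t u b x)) := fun b x => by
    rw [exp_logHeat hu hK, ofReal_integral_eq_lintegral_ofReal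
      (integrable_exp_mul_comp_add hu hK b x) (ae_of_all _ fun z => (Real.exp_pos _).le)]
  have hint : ∀ a b, Integrable (fun x => Real.exp (a * logHeat t u b x)) ν := fun a b => by
    refine Integrable.of_bound (((differentiable_logHeat ht hu hK b).continuous.measurable.const_mul
      _).exp.aestronglyMeasurable) (Real.exp (|a| * (|b| * (|Real.log ε| + |Real.log M|))))
      (ae_of_all _ fun x => ?_)
    rw [Real.norm_of_nonneg (Real.exp_pos _).le]
    refine Real.exp_le_exp.2 ((le_abs_self _).trans ?_)
    rw [abs_mul]
    gcongr
    exact abs_logHeat_le hu hK b x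
  have hout : ∀ a b, ∫⁻ x, ENNReal.ofReal (Real.exp (a * logHeat t u b x)) ∂ν =
      ENNReal.ofReal (∫ x, Real.exp (a * logHeat t u b x) ∂ν) := fun a b =>
    (ofReal_integral_eq_lintegral_ofReal (hint a b) (ae_of_all _ fun z => (Real.exp_pos _).le)).symm
  have hroot : ∀ a b r, ENNReal.ofReal (∫ x, Real.exp (a * logHeat t u b x) ∂ν) ^ (1 / r) =
      ENNReal.ofReal (Real.exp (r⁻¹ * Real.log (∫ x, Real.exp (a * logHeat t u b x) ∂ν))) := by
    intro a b r
    have hp := integral_exp_pos (hint a b)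
    rw [ENNReal.ofReal_rpow_of_pos hp, Real.rpow_def_of_pos hp, one_div, mul_comm]
  have hl : ∫⁻ x, (∫⁻ z, ENNReal.ofReal (h (x + z)) ∂(heatGaussian d t)) ^ P ∂ν =
      ENNReal.ofReal (∫ x, Real.exp (P * logHeat t u 1 x) ∂ν) := by
    rw [← hout]
    refine lintegral_congr fun x => ?_
    have h1 := hin 1 x
    simp only [one_mul, hu_def, Real.exp_log (hh0 _)] at h1
    rw [h1, ENNReal.ofReal_rpow_of_pos (Real.exp_pos _), ← Real.exp_mul, mul_comm]
  have hr : ∫⁻ y, ENNReal.ofReal (h y) ^ Q ∂(heatFlow ν t) =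
      ENNReal.ofReal (∫ x, Real.exp (1 * logHeat t u Q x) ∂ν) := by
    rw [← hout, heatFlow, Measure.lintegral_conv (by fun_prop)]
    refine lintegral_congr fun x => ?_
    rw [one_mul, ← hin]
    refine lintegral_congr fun z => ?_
    rw [ENNReal.ofReal_rpow_of_pos (hh0 _), Real.rpow_def_of_pos (hh0 _), mul_comm]
  rw [hl, hr, hroot, hroot]
  refine ENNReal.ofReal_le_ofReal (Real.exp_le_exp.2 ?_)
  simp only [one_mul]
  exact log_integral_exp_logHeat_le ht hu hK ν hpos hfin hQ.le hPQ

/-- The density `P_t(φ π)` of a nonnegative function, with values in `[0, ∞]`. -/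
noncomputable def heatDensityENN (π : Measure (EuclideanSpace ℝ (Fin d))) (t : ℝ)
    (φ : EuclideanSpace ℝ (Fin d) → ℝ≥0∞) (y : EuclideanSpace ℝ (Fin d)) : ℝ≥0∞ :=
  ∫⁻ x, φ x * ENNReal.ofReal (heatKernel t (y - x)) ∂π

/-- The quotient `P_t(φ π) / P_t π`, the action of `Q_t` on nonnegative functions. -/
noncomputable def heatAdjointENN (π : Measure (EuclideanSpace ℝ (Fin d))) (t : ℝ)
    (φ : EuclideanSpace ℝ (Fin d) → ℝ≥0∞) (y : EuclideanSpace ℝ (Fin d)) : ℝ≥0∞ :=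
  heatDensityENN π t φ y / heatDensityENN π t (fun _ => 1) y

section

variable {t : ℝ} {π : Measure (EuclideanSpace ℝ (Fin d))}

lemma measurable_ofReal_heatKernel_sub :
    Measurable fun p : EuclideanSpace ℝ (Fin d) × EuclideanSpace ℝ (Fin d) =>
      ENNReal.ofReal (heatKernel t (p.1 - p.2)) :=
  ((continuous_heatKernel t).comp (continuous_fst.sub continuous_snd)).measurable.ennreal_ofReal

lemma measurable_ofReal_heatKernel_const_sub (y : EuclideanSpace ℝ (Fin d)) :
    Measurable fun x => ENNReal.ofReal (heatKernel t (y - x)) :=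
  ((continuous_heatKernel t).comp (continuous_const.sub continuous_id)).measurable.ennreal_ofReal

lemma measurable_ofReal_heatKernel_sub_const (x : EuclideanSpace ℝ (Fin d)) :
    Measurable fun y => ENNReal.ofReal (heatKernel t (y - x)) :=
  ((continuous_heatKernel t).comp (continuous_id.sub continuous_const)).measurable.ennreal_ofReal

lemma measurable_heatDensityENN [SFinite π] {φ : EuclideanSpace ℝ (Fin d) → ℝ≥0∞}
    (hφ : Measurable φ) : Measurable (heatDensityENN π t φ) :=
  ((hφ.comp measurable_snd).mul measurable_ofReal_heatKernel_sub).lintegral_prod_right'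

lemma measurable_heatAdjointENN [SFinite π] {φ : EuclideanSpace ℝ (Fin d) → ℝ≥0∞}
    (hφ : Measurable φ) : Measurable (heatAdjointENN π t φ) :=
  (measurable_heatDensityENN hφ).div (measurable_heatDensityENN measurable_const)

lemma heatKernel_le (ht : 0 < t) (z : EuclideanSpace ℝ (Fin d)) :
    heatKernel t z ≤ (2 * Real.pi * t) ^ (-(d : ℝ) / 2) := by
  unfold heatKernel
  refine mul_le_of_le_one_right (by positivity) (Real.exp_le_one_iff.2 ?_)
  exact div_nonpos_of_nonpos_of_nonneg (by simp) (by positivity)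

lemma heatDensityENN_one_ne_top [IsFiniteMeasure π] (ht : 0 < t)
    (y : EuclideanSpace ℝ (Fin d)) : heatDensityENN π t (fun _ => 1) y ≠ ∞ := by
  refine ((lintegral_mono (g := fun _ => ENNReal.ofReal ((2 * Real.pi * t) ^ (-(d : ℝ) / 2)))
    fun x => ?_).trans_lt ?_).ne
  · rw [one_mul]; exact ENNReal.ofReal_le_ofReal (heatKernel_le ht _)
  · rw [lintegral_const]; exact ENNReal.mul_lt_top ENNReal.ofReal_lt_top (measure_lt_top _ _)

lemma heatDensityENN_one_ne_zero [NeZero π] (ht : 0 < t) (y : EuclideanSpace ℝ (Fin d)) :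
    heatDensityENN π t (fun _ => 1) y ≠ 0 := by
  intro h
  unfold heatDensityENN at h
  have hm : Measurable fun x : EuclideanSpace ℝ (Fin d) =>
      (1 : ℝ≥0∞) * ENNReal.ofReal (heatKernel t (y - x)) :=
    (measurable_ofReal_heatKernel_const_sub y).const_mul 1
  rw [lintegral_eq_zero_iff hm] at h
  obtain ⟨x, hx⟩ := h.exists
  simp only [one_mul, Pi.zero_apply, ENNReal.ofReal_eq_zero] at hx
  exact absurd (heatKernel_pos ht (y - x)) (not_lt.2 hx)

/-- The measure `π_t` has Lebesgue density `P_t π`. -/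
lemma lintegral_heatFlow [SFinite π] (ht : 0 < t) {h : EuclideanSpace ℝ (Fin d) → ℝ≥0∞}
    (hh : Measurable h) :
    ∫⁻ y, h y ∂(heatFlow π t) = ∫⁻ y, heatDensityENN π t (fun _ => 1) y * h y := by
  rw [heatFlow, Measure.lintegral_conv hh]
  simp only [lintegral_gaussian_add ht hh]
  rw [lintegral_lintegral_swap]
  · refine lintegral_congr fun y => ?_
    rw [lintegral_mul_const _ (measurable_ofReal_heatKernel_const_sub y)]
    simp only [heatDensityENN, one_mul]
  · have hm : Measurable fun p : EuclideanSpace ℝ (Fin d) × EuclideanSpace ℝ (Fin d) =>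
        ENNReal.ofReal (heatKernel t (p.2 - p.1)) :=
      ((continuous_heatKernel t).comp
        (continuous_snd.sub continuous_fst)).measurable.ennreal_ofReal
    exact (hm.mul (hh.comp measurable_snd)).aemeasurable

lemma heatDensityENN_mul_heatAdjointENN [IsFiniteMeasure π] [NeZero π] (ht : 0 < t)
    (φ : EuclideanSpace ℝ (Fin d) → ℝ≥0∞) (y : EuclideanSpace ℝ (Fin d)) :
    heatDensityENN π t (fun _ => 1) y * heatAdjointENN π t φ y = heatDensityENN π t φ y :=
  ENNReal.mul_div_cancel (heatDensityENN_one_ne_zero ht y) (heatDensityENN_one_ne_top ht y)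

/-- `Q_t` is the adjoint of the heat semigroup. -/
lemma lintegral_heatAdjointENN_mul [IsFiniteMeasure π] [NeZero π] (ht : 0 < t)
    {φ h : EuclideanSpace ℝ (Fin d) → ℝ≥0∞} (hφ : Measurable φ) (hh : Measurable h) :
    ∫⁻ y, heatAdjointENN π t φ y * h y ∂(heatFlow π t) =
      ∫⁻ x, φ x * ∫⁻ z, h (x + z) ∂(heatGaussian d t) ∂π := by
  rw [lintegral_heatFlow (h := fun y => heatAdjointENN π t φ y * h y) ht
    ((measurable_heatAdjointENN hφ).mul hh)]
  simp only [← mul_assoc, heatDensityENN_mul_heatAdjointENN ht, lintegral_gaussian_add ht hh]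
  have e1 : ∀ y, heatDensityENN π t φ y * h y =
      ∫⁻ x, φ x * ENNReal.ofReal (heatKernel t (y - x)) * h y ∂π := fun y => by
    rw [heatDensityENN, lintegral_mul_const]
    exact hφ.mul (measurable_ofReal_heatKernel_const_sub y)
  have e2 : ∀ x, φ x * ∫⁻ y, ENNReal.ofReal (heatKernel t (y - x)) * h y =
      ∫⁻ y, φ x * ENNReal.ofReal (heatKernel t (y - x)) * h y := fun x => by
    rw [← lintegral_const_mul]
    · simp only [mul_assoc]
    · exact (measurable_ofReal_heatKernel_sub_const x).mul hh
  simp only [e1, e2]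
  rw [lintegral_lintegral_swap]
  exact (((hφ.comp measurable_snd).mul measurable_ofReal_heatKernel_sub).mul
    (hh.comp measurable_fst)).aemeasurable

/-- Hypercontractivity of `Q_t` on nonnegative functions: the dual inequality is tested against a
bounded truncation of `(Q_t φ)^(q - 1)`. -/
lemma lintegral_heatAdjointENN_rpow_le (ht : 0 < t) (ν : Measure (EuclideanSpace ℝ (Fin d)))
    [IsProbabilityMeasure ν] (hpos : 0 < lsiConst ν) (hfin : lsiConst ν < ∞) {p q : ℝ}
    (hp : 1 < p) (hq1 : 1 < q) (hq : (q - 1) / (p - 1) = 1 + t / (lsiConst ν).toReal)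
    {φ : EuclideanSpace ℝ (Fin d) → ℝ≥0∞} (hφ : Measurable φ) :
    (∫⁻ y, heatAdjointENN ν t φ y ^ q ∂(heatFlow ν t)) ^ (1 / q) ≤
      (∫⁻ x, φ x ^ p ∂ν) ^ (1 / p) := by
  have hp0 : 0 < p - 1 := by linarith
  have hq0 : 0 < q - 1 := by linarith
  have hqpos : 0 < q := by linarith
  set P := p / (p - 1) with hP
  set Q := q / (q - 1) with hQ
  have hQ1 : 1 < Q := by rw [hQ, one_lt_div hq0]; linarith
  have hQ0 : 0 < Q := by linarith
  have hPQ : P - 1 = (1 + t / (lsiConst ν).toReal) * (Q - 1) := by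
    rw [← hq, hP, hQ]; field_simp; ring
  have hconj : p.HolderConjugate P := Real.HolderConjugate.conjExponent hp
  set k := heatAdjointENN ν t φ with hk_def
  have hk : Measurable k := measurable_heatAdjointENN hφ
  set N := (∫⁻ x, φ x ^ p ∂ν) ^ (1 / p) with hN
  rcases eq_or_ne N ∞ with hNtop | hNtop
  · rw [hNtop]; exact le_top
  have hmain : ∀ n : ℕ, ∫⁻ y, (min (k y) n) ^ q ∂(heatFlow ν t) ≤ N ^ q := by
    intro n
    set I := ∫⁻ y, (min (k y) n) ^ q ∂(heatFlow ν t) with hI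
    have hmin : ∀ y, min (k y) n ≠ ∞ := fun y =>
      ((min_le_right _ _).trans_lt (ENNReal.natCast_lt_top n)).ne
    have hItop : I ≠ ∞ := by
      refine ((lintegral_mono (g := fun _ => (n : ℝ≥0∞) ^ q) fun y => ?_).trans_lt ?_).ne
      · exact ENNReal.rpow_le_rpow (min_le_right _ _) hqpos.le
      · simp [ENNReal.rpow_lt_top_of_nonneg hqpos.le (ENNReal.natCast_ne_top n)]
    -- The dual inequality needs test functions bounded below, hence the cutoff at `ε`.
    have hε : ∀ ε : ℝ, 0 < ε → I ≤ N * (I + ENNReal.ofReal ε ^ Q) ^ (1 / Q) := by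
      intro ε hε
      set h : EuclideanSpace ℝ (Fin d) → ℝ := fun y => max ((min (k y) n).toReal ^ (q - 1)) ε
        with hh_def
      have hh : Measurable h := (((hk.min measurable_const).ennreal_toReal).pow_const _).max
        measurable_const
      have hof : ∀ y, ENNReal.ofReal (h y) = max ((min (k y) n) ^ (q - 1)) (ENNReal.ofReal ε) := by
        intro y
        simp only [hh_def]
        rw [ENNReal.ofReal_max, ← ENNReal.ofReal_rpow_of_nonneg ENNReal.toReal_nonneg hq0.le,
          ENNReal.ofReal_toReal (hmin y)]
      have hdual := lintegral_heat_rpow_le ht ν hpos hfin hQ1 hPQ hh hε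
        (fun x => le_max_right _ _) (M := max ((n : ℝ) ^ (q - 1)) ε) (fun y => by
          refine max_le_max ?_ le_rfl
          refine Real.rpow_le_rpow ENNReal.toReal_nonneg ?_ hq0.le
          exact ENNReal.toReal_le_of_le_ofReal (Nat.cast_nonneg n)
            ((min_le_right _ _).trans_eq (by simp)))
      have hhE : Measurable fun y => ENNReal.ofReal (h y) := hh.ennreal_ofReal
      have hPh : Measurable fun x => ∫⁻ z, ENNReal.ofReal (h (x + z)) ∂(heatGaussian d t) :=
        (hhE.comp (measurable_fst.add measurable_snd)).lintegral_prod_right'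
      calc I ≤ ∫⁻ y, k y * ENNReal.ofReal (h y) ∂(heatFlow ν t) := by
            refine lintegral_mono fun y => ?_
            rw [hof, show q = 1 + (q - 1) by ring,
              ENNReal.rpow_add_of_nonneg _ _ zero_le_one hq0.le,
              ENNReal.rpow_one, add_sub_cancel_left]
            exact mul_le_mul' (min_le_left _ _) (le_max_left _ _)
        _ = ∫⁻ x, φ x * ∫⁻ z, ENNReal.ofReal (h (x + z)) ∂(heatGaussian d t) ∂ν :=
            lintegral_heatAdjointENN_mul ht hφ hhE
        _ ≤ N * (∫⁻ x, (∫⁻ z, ENNReal.ofReal (h (x + z)) ∂(heatGaussian d t)) ^ P ∂ν) ^ (1 / P) :=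
            ENNReal.lintegral_mul_le_Lp_mul_Lq ν hconj hφ.aemeasurable hPh.aemeasurable
        _ ≤ N * (∫⁻ y, ENNReal.ofReal (h y) ^ Q ∂(heatFlow ν t)) ^ (1 / Q) := by gcongr
        _ ≤ N * (I + ENNReal.ofReal ε ^ Q) ^ (1 / Q) := by
            gcongr
            have : I + ENNReal.ofReal ε ^ Q =
                ∫⁻ y, ((min (k y) n) ^ q + ENNReal.ofReal ε ^ Q) ∂(heatFlow ν t) := by
              rw [lintegral_add_right _ measurable_const]; simp [hI]
            rw [this]
            refine lintegral_mono fun y => ?_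
            rw [hof, (ENNReal.monotone_rpow_of_nonneg hQ0.le).map_max, ← ENNReal.rpow_mul,
              show (q - 1) * Q = q by rw [hQ]; field_simp]
            exact max_le (le_add_right le_rfl) (le_add_left le_rfl)
    have hlim : I ≤ N * I ^ (1 / Q) := by
      have hc : Continuous fun ε : ℝ => N * (I + ENNReal.ofReal ε ^ Q) ^ (1 / Q) :=
        (ENNReal.continuous_const_mul hNtop).comp (ENNReal.continuous_rpow_const.comp
          (continuous_const.add (ENNReal.continuous_rpow_const.comp ENNReal.continuous_ofReal)))
      have h0 := (hc.tendsto 0).mono_left (nhdsWithin_le_nhds (s := Set.Ioi (0 : ℝ)))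
      simp only [ENNReal.ofReal_zero, ENNReal.zero_rpow_of_pos hQ0, add_zero] at h0
      exact ge_of_tendsto h0 (eventually_mem_nhdsWithin.mono fun ε h => hε ε h)
    rcases eq_or_ne I 0 with hI0 | hI0
    · rw [hI0]; exact zero_le
    · have hsum : 1 / q + 1 / Q = 1 := by rw [hQ]; field_simp; ring
      have h1 : I ^ (1 / q) * I ^ (1 / Q) ≤ N * I ^ (1 / Q) := by
        rw [← ENNReal.rpow_add _ _ hI0 hItop, hsum, ENNReal.rpow_one]; exact hlim
      have h2 : I ^ (1 / q) ≤ N := (ENNReal.mul_le_mul_iff_left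
        (ENNReal.rpow_pos (pos_iff_ne_zero.2 hI0) hItop).ne'
        (ENNReal.rpow_ne_top_of_nonneg (by positivity) hItop)).1 h1
      rwa [one_div, ENNReal.rpow_inv_le_iff hqpos] at h2
  rw [one_div, ENNReal.rpow_inv_le_iff hqpos]
  have hmc := lintegral_tendsto_of_tendsto_of_monotone (μ := heatFlow ν t)
    (f := fun (n : ℕ) y => (min (k y) n) ^ q) (F := fun y => k y ^ q)
    (fun n => ((hk.min measurable_const).pow_const q).aemeasurable)
    (ae_of_all _ fun y m n hmn => ENNReal.rpow_le_rpow
      (min_le_min le_rfl (by exact_mod_cast hmn)) hqpos.le)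
    (ae_of_all _ fun y => by
      have h1 : Tendsto (fun n : ℕ => min (k y) (n : ℝ≥0∞)) atTop (𝓝 (min (k y) ∞)) :=
        tendsto_const_nhds.min ENNReal.tendsto_nat_nhds_top
      rw [min_eq_left le_top] at h1
      exact (ENNReal.continuous_rpow_const.tendsto (k y)).comp h1)
  exact le_of_tendsto' hmc hmain

end

/-! ### Hypercontractivity and Rényi divergences -/

section

variable {t : ℝ} {ν : Measure (EuclideanSpace ℝ (Fin d))}

lemma heatDensity_one_eq_toReal (ht : 0 < t) (y : EuclideanSpace ℝ (Fin d)) :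
    heatDensity ν t (fun _ => 1) y = (heatDensityENN ν t (fun _ => 1) y).toReal := by
  simp only [heatDensity, heatDensityENN, one_mul]
  refine integral_eq_lintegral_of_nonneg_ae (ae_of_all _ fun x => (heatKernel_pos ht _).le) ?_
  exact ((continuous_heatKernel t).comp
    (continuous_const.sub continuous_id)).measurable.aestronglyMeasurable

lemma enorm_heatAdjoint_le [IsFiniteMeasure ν] [NeZero ν] (ht : 0 < t)
    (f : EuclideanSpace ℝ (Fin d) → ℝ) (y : EuclideanSpace ℝ (Fin d)) :
    ‖heatAdjoint ν t f y‖ₑ ≤ heatAdjointENN ν t (fun x => ‖f x‖ₑ) y := by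
  have hv0 := heatDensityENN_one_ne_zero (π := ν) ht y
  have hvt := heatDensityENN_one_ne_top (π := ν) ht y
  have hpos := ENNReal.toReal_pos hv0 hvt
  rw [heatAdjoint, if_neg ht.ne', heatAdjointENN, heatDensity_one_eq_toReal ht, div_eq_mul_inv,
    enorm_mul, enorm_inv hpos.ne', Real.enorm_of_nonneg hpos.le, ENNReal.ofReal_toReal hvt,
    ← div_eq_mul_inv]
  gcongr
  refine (enorm_integral_le_lintegral_enorm _).trans (le_of_eq (lintegral_congr fun x => ?_))
  rw [enorm_mul, Real.enorm_of_nonneg (heatKernel_pos ht _).le]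

lemma measurable_heatDensity [SFinite ν] {f : EuclideanSpace ℝ (Fin d) → ℝ} (hf : Measurable f) :
    Measurable (heatDensity ν t f) := by
  have hm : Measurable fun p : EuclideanSpace ℝ (Fin d) × EuclideanSpace ℝ (Fin d) =>
      f p.2 * heatKernel t (p.1 - p.2) :=
    (hf.comp measurable_snd).mul
      ((continuous_heatKernel t).comp (continuous_fst.sub continuous_snd)).measurable
  exact (hm.stronglyMeasurable.integral_prod_right' (ν := ν)).measurable

lemma heatAdjoint_congr_ae (ht : 0 < t) {f g : EuclideanSpace ℝ (Fin d) → ℝ} (h : f =ᵐ[ν] g) :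
    heatAdjoint ν t f = heatAdjoint ν t g := by
  funext y
  have : heatDensity ν t f y = heatDensity ν t g y :=
    integral_congr_ae (h.mono fun x hx => by simp only [hx])
  simp only [heatAdjoint, if_neg ht.ne', this]

/-- Hypercontractivity of `Q_t` between `L^p(ν)` and `L^q(ν_t)`. -/
lemma eLpNorm_heatAdjoint_le [IsProbabilityMeasure ν] (ht : 0 < t) (hpos : 0 < lsiConst ν)
    (hfin : lsiConst ν < ∞) {p q : ℝ} (hp : 1 < p) (hq1 : 1 < q)
    (hq : (q - 1) / (p - 1) = 1 + t / (lsiConst ν).toReal) {f : EuclideanSpace ℝ (Fin d) → ℝ}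
    (hf : MemLp f (ENNReal.ofReal p) ν) :
    MemLp (heatAdjoint ν t f) (ENNReal.ofReal q) (heatFlow ν t) ∧
      eLpNorm (heatAdjoint ν t f) (ENNReal.ofReal q) (heatFlow ν t) ≤
        eLpNorm f (ENNReal.ofReal p) ν := by
  wlog hfm : Measurable f generalizing f
  · have h := this (hf.ae_eq hf.1.ae_eq_mk) hf.1.stronglyMeasurable_mk.measurable
    rwa [← heatAdjoint_congr_ae ht hf.1.ae_eq_mk, ← eLpNorm_congr_ae hf.1.ae_eq_mk] at h
  have hmeas : Measurable (heatAdjoint ν t f) := by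
    have : heatAdjoint ν t f = fun y => heatDensity ν t f y / heatDensity ν t (fun _ => 1) y := by
      funext y; rw [heatAdjoint, if_neg ht.ne']
    rw [this]
    exact (measurable_heatDensity hfm).div (measurable_heatDensity measurable_const)
  have hp0 : 0 < p := by linarith
  have hq0 : 0 < q := by linarith
  have hle : eLpNorm (heatAdjoint ν t f) (ENNReal.ofReal q) (heatFlow ν t) ≤
      eLpNorm f (ENNReal.ofReal p) ν := by
    rw [eLpNorm_eq_lintegral_rpow_enorm_toReal (by simpa using hq0) ENNReal.ofReal_ne_top,
      eLpNorm_eq_lintegral_rpow_enorm_toReal (by simpa using hp0) ENNReal.ofReal_ne_top,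
      ENNReal.toReal_ofReal hp0.le, ENNReal.toReal_ofReal hq0.le]
    refine le_trans ?_ (lintegral_heatAdjointENN_rpow_le ht ν hpos hfin hp hq1 hq hfm.enorm)
    gcongr with y
    exact enorm_heatAdjoint_le ht f y
  exact ⟨⟨hmeas.aestronglyMeasurable, hle.trans_lt hf.2⟩, hle⟩

lemma heatFlow_withDensity [IsProbabilityMeasure ν] (ht : 0 < t)
    {φ : EuclideanSpace ℝ (Fin d) → ℝ≥0∞} (hφ : Measurable φ) [SFinite (ν.withDensity φ)] :
    heatFlow (ν.withDensity φ) t = (heatFlow ν t).withDensity (heatAdjointENN ν t φ) := by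
  ext s hs
  have hk := measurable_heatAdjointENN (t := t) (π := ν) hφ
  have h1 : Measurable (s.indicator (1 : EuclideanSpace ℝ (Fin d) → ℝ≥0∞)) :=
    measurable_one.indicator hs
  have h2 : Measurable fun x =>
      ∫⁻ z, s.indicator (1 : EuclideanSpace ℝ (Fin d) → ℝ≥0∞) (x + z) ∂(heatGaussian d t) :=
    (h1.comp (measurable_fst.add measurable_snd)).lintegral_prod_right'
  rw [← lintegral_indicator_one hs, heatFlow, Measure.lintegral_conv h1,
    lintegral_withDensity_eq_lintegral_mul _ hφ h2, withDensity_apply _ hs,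
    ← lintegral_indicator hs]
  refine (lintegral_heatAdjointENN_mul ht hφ h1).symm.trans (lintegral_congr fun y => ?_)
  by_cases hy : y ∈ s <;> simp [hy]

/-- Rényi divergences contract because they are multiples of logarithms of the norms of `dμ/dν` and
of `dμ_t/dν_t = Q_t (dμ/dν)`. The multiples are `p / (p - 1) ≥ q / (q - 1)`, so the comparison also
uses that the logarithm of `‖dμ/dν‖_p` is nonnegative. -/
lemma renyiDiv_heatFlow_le [IsProbabilityMeasure ν] (ht : 0 < t) (hpos : 0 < lsiConst ν)
    (hfin : lsiConst ν < ∞) {p q : ℝ} (hp : 1 < p) (hpq : p ≤ q)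
    (hq : (q - 1) / (p - 1) = 1 + t / (lsiConst ν).toReal)
    (μ : Measure (EuclideanSpace ℝ (Fin d))) [IsProbabilityMeasure μ] (hμ : μ ≪ ν) :
    renyiDiv q (heatFlow μ t) (heatFlow ν t) ≤ renyiDiv p μ ν := by
  have hp0 : 0 < p := by linarith
  have hq0 : 0 < q := by linarith
  have : SFinite μ := instSFiniteOfSigmaFinite
  have : μ.HaveLebesgueDecomposition ν := Measure.haveLebesgueDecomposition_of_sigmaFinite μ ν
  set φ := μ.rnDeriv ν
  have hφ : Measurable φ := Measure.measurable_rnDeriv μ ν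
  have hμφ : ν.withDensity φ = μ := Measure.withDensity_rnDeriv_eq μ ν hμ
  have hflow : heatFlow μ t = (heatFlow ν t).withDensity (heatAdjointENN ν t φ) := by
    have : SFinite (ν.withDensity φ) := by rw [hμφ]; infer_instance
    rw [← heatFlow_withDensity ht hφ, hμφ]
  have hder : (heatFlow μ t).rnDeriv (heatFlow ν t) =ᵐ[heatFlow ν t] heatAdjointENN ν t φ := by
    rw [hflow]
    exact Measure.rnDeriv_withDensity _ (measurable_heatAdjointENN hφ)
  have hac : heatFlow μ t ≪ heatFlow ν t := by
    rw [hflow]; exact withDensity_absolutelyContinuous _ _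
  have hX := lintegral_heatAdjointENN_rpow_le ht ν hpos hfin hp (hp.trans_le hpq) hq hφ
  rw [renyiDiv, renyiDiv, if_pos hac, if_pos hμ,
    lintegral_congr_ae (g := fun y => heatAdjointENN ν t φ y ^ q)
      (hder.mono fun y hy => by simp only [hy])]
  set X := ∫⁻ y, heatAdjointENN ν t φ y ^ q ∂(heatFlow ν t)
  set Y := ∫⁻ x, φ x ^ p ∂ν
  have hY1 : 1 ≤ Y := by
    have h := ENNReal.lintegral_mul_le_Lp_mul_Lq ν (Real.HolderConjugate.conjExponent hp)
      hφ.aemeasurable (g := fun _ => 1) aemeasurable_const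
    have hone : ∫⁻ x, φ x ∂ν = 1 := by
      rw [Measure.lintegral_rnDeriv hμ]; simp
    simp only [Pi.mul_apply, mul_one, hone, ENNReal.one_rpow, lintegral_const, measure_univ] at h
    by_contra hlt
    exact absurd h (not_le.2 (ENNReal.rpow_lt_one (not_le.1 hlt) (by positivity)))
  have hXY : X ≤ Y ^ (q / p) := by
    rw [one_div, ENNReal.rpow_inv_le_iff hq0, ← ENNReal.rpow_mul] at hX
    exact hX.trans_eq (by congr 1; ring)
  have hlogY : 0 ≤ ENNReal.log Y := by
    rw [← ENNReal.log_one]; exact ENNReal.log_monotone hY1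
  have hcoef : (q - 1)⁻¹ * (q / p) ≤ (p - 1)⁻¹ := by
    rw [← div_eq_inv_mul, div_div, inv_eq_one_div, div_le_div_iff₀ (by nlinarith) (by linarith)]
    nlinarith
  calc (((q - 1)⁻¹ : ℝ) : EReal) * ENNReal.log X
      ≤ (((q - 1)⁻¹ : ℝ) : EReal) * (((q / p : ℝ) : EReal) * ENNReal.log Y) := by
        rw [← ENNReal.log_rpow (x := Y)]
        have : (0 : ℝ) ≤ (q - 1)⁻¹ := inv_nonneg.2 (by linarith)
        exact mul_le_mul_of_nonneg_left (ENNReal.log_monotone hXY) (EReal.coe_nonneg.2 this)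
    _ = (((q - 1)⁻¹ * (q / p) : ℝ) : EReal) * ENNReal.log Y := by
        rw [EReal.coe_mul, mul_assoc]
    _ ≤ (((p - 1)⁻¹ : ℝ) : EReal) * ENNReal.log Y :=
        mul_le_mul_of_nonneg_right (by exact_mod_cast hcoef) hlogY

end

end

theorem theorem2 {d : ℕ} (ν : Measure (EuclideanSpace ℝ (Fin d))) [IsProbabilityMeasure ν]
    (hpos : 0 < lsiConst ν) (hfin : lsiConst ν < ∞)
    (p : ℝ) (hp : 1 < p) (t : ℝ) (ht : 0 ≤ t)
    (q : ℝ) (hq : (q - 1) / (p - 1) = 1 + t / (lsiConst ν).toReal) :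
    (∀ f : EuclideanSpace ℝ (Fin d) → ℝ, MemLp f (ENNReal.ofReal p) ν →
      MemLp (heatAdjoint ν t f) (ENNReal.ofReal q) (heatFlow ν t) ∧
      eLpNorm (heatAdjoint ν t f) (ENNReal.ofReal q) (heatFlow ν t) ≤
        eLpNorm f (ENNReal.ofReal p) ν) ∧
    (∀ μ : Measure (EuclideanSpace ℝ (Fin d)), IsProbabilityMeasure μ → μ ≪ ν →
      renyiDiv q (heatFlow μ t) (heatFlow ν t) ≤ renyiDiv p μ ν) := by
  have hp1 : 0 < p - 1 := by linarith
  rcases ht.eq_or_lt with rfl | ht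
  · have hqp : q = p := by
      rw [zero_div, add_zero, div_eq_one_iff_eq hp1.ne'] at hq
      linarith
    subst hqp
    refine ⟨fun f hf => ?_, fun μ _ _ => ?_⟩
    · have : heatAdjoint ν 0 f = f := by funext y; simp [heatAdjoint]
      rw [this, heatFlow_zero]
      exact ⟨hf, le_rfl⟩
    · rw [heatFlow_zero, heatFlow_zero]
  · have hpq : p ≤ q := by
      have h1 : 1 ≤ (q - 1) / (p - 1) := by
        rw [hq]; exact le_add_of_nonneg_right (by positivity)
      rw [le_div_iff₀ hp1] at h1
      linarith
    exact ⟨fun f hf => eLpNorm_heatAdjoint_le ht hpos hfin hp (hp.trans_le hpq) hq hf,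
      fun μ _ hμ => renyiDiv_heatFlow_le ht hpos hfin hp hpq hq μ hμ⟩
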